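/- A temporal graph $\mathcal G=(V,E)$ consists of a finite vertex set $V$ and a finite set $E\subseteq V\times V\times\mathbb N\times\mathbb N$ of time arcs; a time arc $e=(v,w,t,\lambda)$ has start vertex $v$, end vertex $w$, time label $t$ and traversal time $\lambda$. An instance of \textsc{Delayed-Routing Path Game} consists of a temporal graph $\mathcal G=(V,E)$, vertices $s,z\in V$, and $x,\delta\in\mathbb N$. Two players, the traveler and the adversary, play as follows. The traveler starts at vertex $s$ at time step $0$. As long as the current vertex is not $z$, the traveler, being at vertex $v$ at time $t$, chooses a time arc $(v,w,t',\lambda)\in E$ with $t'\ge t$ whose end vertex $w$ has not been visited before ($s$ counts as visited). The adversary, seeing this choice, may delay this arc, provided that fewer than $x$ arcs have been delayed so far. The traveler then is at $w$, at time $t'+\lambda$ if the arc was not delayed and at time $t'+\lambda+\delta$ if it was. The traveler wins if $z$ is reached (immediately, if $s=z$); otherwise, in particular if no arc can be chosen, the adversary wins. The question is whether the traveler has a winning strategy, that is, a strategy (choosing the next arc from the history of the game) that reaches $z$ against every strategy of the adversary. An instance with $V=\{0,\dots,n-1\}$ is encoded as the word over $\{0,1,\#\}$ that lists the numbers $n,s,z,x,\delta$,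 followed by the entries $v,w,t,\lambda$ of all time arcs, the arcs being listed in any order (repetitions allowed), where each number is written in binary (least significant bit first, without superfluous zeros, so that $0$ is the empty word) and followed by $\#$. Proposition. \textsc{Delayed-Routing Path Game} is contained in PSPACE: there are a deterministic (multi-stack) Turing machine $M$ and a polynomial $p$ such that on every word $u$ over $\{0,1,\#\}$ the machine $M$ halts, uses at most $p(|u|)$ cells, and accepts if and only if $u$ encodes an instance in which the traveler has a winning strategy. -/

import Mathlib

/-! ### Polynomial space -/

/-- A machine has finitely many stacks. -/
instance FinTM2.fintypeStacks (tm : Turing.FinTM2) : Fintype tm.K := tm.kFin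

/-- A deterministic multi-stack Turing machine that decides `L` in polynomial space: started on a
word `w` over `Γ`, it halts with exactly the answer bit `w ∈ L` on its output stack, and in every
configuration reached on the way the total number of symbols stored on all stacks (the input stack
included) is at most `space` evaluated at the length of `w`. The finiteness of the control (labels,
internal states, number of stacks) is part of `Turing.FinTM2`. -/
structure PolySpaceDecider {Γ : Type} (L : Language Γ) extends Turing.TM2ComputableAux Γ Bool where
  /-- every stack has a finite alphabet -/
  alphabetFinite : ∀ k, Finite (tm.Γ k)
  /-- the polynomial that bounds the space -/
  space : Polynomial ℕ
  /-- the machine halts on every word, with the correct answer -/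
  outputs : ∀ w : List Γ, ∀ b : Bool, (b = true ↔ w ∈ L) →
    Turing.TM2Outputs tm (w.map inputAlphabet.invFun)
      (some ((Computability.encodeBool b).map outputAlphabet.invFun))
  /-- no configuration reached from the input `w` uses more than `space` of `w.length` cells -/
  space_le : ∀ (w : List Γ) (c : tm.Cfg),
    StateTransition.Reaches tm.step (Turing.initList tm (w.map inputAlphabet.invFun)) c →
      ∑ k, (c.stk k).length ≤ space.eval w.length

/-- The class of the languages over the alphabet `Γ` that are decidable in polynomial space. -/
def PSPACE (Γ : Type) : Set (Language Γ) := {L | Nonempty (PolySpaceDecider L)}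

/-! ### Temporal graphs and the Delayed-Routing Path Game -/

/-- A time arc `(v, w, t, λ)` on the vertex set `Fin n`. -/
structure TimeArc (n : ℕ) where
  /-- the start vertex -/
  src : Fin n
  /-- the end vertex -/
  dst : Fin n
  /-- the time label -/
  time : ℕ
  /-- the traversal time -/
  trav : ℕ

/-- An instance of the game: a temporal graph with vertex set `Fin n` and a finite set of time arcs,
start vertex `s`, target vertex `z`, the number `x` of available delays, and the length `δ` of a
delay. -/
structure PathGame where
  /-- the number of vertices -/
  n : ℕ
  /-- the set of time arcs -/
  arcs : Finset (TimeArc n)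
  /-- the start vertex -/
  s : Fin n
  /-- the target vertex -/
  z : Fin n
  /-- the number of arcs that the adversary may delay -/
  x : ℕ
  /-- the amount by which a delayed arc is delayed -/
  δ : ℕ

namespace PathGame

variable (G : PathGame)

/-- A game position on the traveler's turn. -/
structure Position where
  /-- the current vertex -/
  vertex : Fin G.n
  /-- the current time step -/
  time : ℕ
  /-- the number of delays that the adversary has left -/
  budget : ℕ
  /-- the vertices visited so far, including the current one -/
  visited : Finset (Fin G.n)

/-- One round: the arc chosen by the traveler, and whether the adversary delays it. -/
abbrev Round : Type := TimeArc G.n × Bool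

/-- The initial position. -/
def start : G.Position where
  vertex := G.s
  time := 0
  budget := G.x
  visited := {G.s}

/-- The position after a round. -/
def next (p : G.Position) (r : G.Round) : G.Position where
  vertex := r.1.dst
  time := r.1.time + r.1.trav + if r.2 = true then G.δ else 0
  budget := if r.2 = true then p.budget - 1 else p.budget
  visited := insert r.1.dst p.visited

/-- The position after a sequence of rounds, the first round being the head of the list. -/
def position (h : List G.Round) : G.Position := h.foldl G.next G.start

/-- The traveler may take the arc `e` at `p`: it leaves the current vertex, not before the current
time, towards a vertex that has not been visited. -/
def Available (p : G.Position) (e : TimeArc G.n) : Prop :=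
  e ∈ G.arcs ∧ e.src = p.vertex ∧ p.time ≤ e.time ∧ e.dst ∉ p.visited

/-- A strategy of the traveler chooses an arc, given the rounds played so far. -/
abbrev TravelerStrategy : Type := List G.Round → TimeArc G.n

/-- A strategy of the adversary decides whether to delay the arc that the traveler has just chosen,
given the rounds played before. -/
abbrev AdversaryStrategy : Type := List G.Round → TimeArc G.n → Bool

/-- The adversary delays an arc only when there is a delay left. -/
def AdversaryStrategy.Legal {G : PathGame} (τ : G.AdversaryStrategy) : Prop :=
  ∀ h e, τ h e = true → 0 < (G.position h).budget

/-- `G.Play σ τ h`: when the players follow `σ` and `τ`, the first rounds of the game are `h`. The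
game ends when the traveler is at `z`, and also when `σ` does not provide an available arc. -/
inductive Play (σ : G.TravelerStrategy) (τ : G.AdversaryStrategy) : List G.Round → Prop
  | start : Play σ τ []
  | round {h : List G.Round} : Play σ τ h → (G.position h).vertex ≠ G.z →
      G.Available (G.position h) (σ h) → Play σ τ (h ++ [(σ h, τ h (σ h))])

/-- The traveler's strategy `σ` is winning: against every legal strategy of the adversary, the
traveler reaches `z` after finitely many rounds. -/
def IsWinning (σ : G.TravelerStrategy) : Prop :=
  ∀ τ : G.AdversaryStrategy, τ.Legal → ∃ h, G.Play σ τ h ∧ (G.position h).vertex = G.z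

/-- `G` is a yes-instance: the traveler has a winning strategy. -/
def TravelerWins : Prop := ∃ σ : G.TravelerStrategy, G.IsWinning σ

end PathGame

/-! ### The decision problem as a language -/

/-- A list of natural numbers as a word over `{0, 1, #}`: each number in binary (least significant
bit first, without superfluous zeros), followed by the separator `# = none`. -/
def encodeNats (l : List ℕ) : List (Option Bool) :=
  l.flatMap fun m => (Computability.encodeNat m).map some ++ [none]

/-- `w` encodes the instance `G`: it lists the numbers `n, s, z, x, δ` and then, in some order, the
time arcs, each by its four entries `v, w, t, λ`. -/
def PathGame.IsEncoding (G : PathGame) (w : List (Option Bool)) : Prop :=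
  ∃ l : List (TimeArc G.n), (∀ e, e ∈ l ↔ e ∈ G.arcs) ∧
    w = encodeNats ([G.n, (G.s : ℕ), (G.z : ℕ), G.x, G.δ] ++
      l.flatMap fun e => [(e.src : ℕ), (e.dst : ℕ), e.time, e.trav])

/-- Delayed-Routing Path Game, as the language of the encodings of its yes-instances. -/
def delayedRoutingPathGame : Language (Option Bool) :=
  {w | ∃ G : PathGame, G.IsEncoding w ∧ G.TravelerWins}

/-! Every move visits a new vertex, so the game tree has finite depth, and the winner is found by
backward induction: a position is winning if it is at `z`, or if some available arc leads to a
winning position both undelayed and, when budget is left, delayed (`travelerWins_iff`). A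
depth-first search evaluates this recursion and stores only the branch being explored.

The number of vertices is written in binary and may be exponential in the input length, so it does
not bound the depth usefully. But the end vertices of the rounds on a branch are distinct and all
occur as end vertices of listed arcs, so the depth is at most the number of arcs
(`Search.Valid.length_frames_le`). A round on the branch is remembered as its arc, the arcs not yet
tried (together a suffix of the arc list) and one delay bit; hence the branch takes quadratic space.
Vertex, time and visited set are read off the branch: the time is the label plus the traversal time
of the last arc, plus `δ` if it was delayed. The budget is a binary counter of fixed width.
Correctness of this search as an abstract transition system is `search_scan` and `search_down`.

To reach Turing machines, the search is written in a small language of stack programs. `Runs` is its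
big-step semantics, which carries a bound on the total stack size through the whole run;
`Runs.exists_path` compiles a run into a machine path with the same bound, and `mem_PSPACE` turns a
deciding program into a member of `PSPACE`. `exists_runs_search` simulates each abstract step by one
loop iteration. Around the search, a finite automaton recognizes lists of `5 + 4 * m` canonically
written numbers (`wordAccepts_iff`), vertex ranges are checked, and unique decoding
(`eq_of_isEncoding`) shows that the instance read is the only one the word can encode. -/

/-! ### A small programming language for multi-stack machines -/

/-- Programs that act on stacks over the alphabet `Sym`, indexed by `W`, and return a value. -/
inductive Cmd (W Sym : Type) : Type → Type 1
  | pure {α : Type} (a : α) : Cmd W Sym α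
  | pop (k : W) : Cmd W Sym (Option Sym)
  | push (k : W) (s : Sym) : Cmd W Sym Unit
  | bind {α β : Type} [Finite α] (c : Cmd W Sym α) (f : α → Cmd W Sym β) : Cmd W Sym β
  | iter {τ β : Type} [Finite τ] (f : τ → Cmd W Sym (τ ⊕ β)) (t : τ) : Cmd W Sym β

namespace Cmd

open Turing StateTransition Relation

variable {W Sym : Type}

/-- The labels of the compiled program. -/
def Label : {α : Type} → Cmd W Sym α → Type
  | _, pure _ => Unit
  | _, pop _ => Unit
  | _, push _ _ => Unit
  | _, @bind _ _ α _ _ c f => c.Label ⊕ Σ a : α, (f a).Label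
  | _, @iter _ _ τ _ _ f _ => Σ t : τ, (f t).Label

/-- The label at which the compiled program starts. -/
def entry : {α : Type} → (c : Cmd W Sym α) → c.Label
  | _, pure _ => ()
  | _, pop _ => ()
  | _, push _ _ => ()
  | _, bind c _ => Sum.inl c.entry
  | _, iter f t => ⟨t, (f t).entry⟩

/-- Returned values and loop states live in the finite control: there is one copy of a continuation
for each value. This is why `bind` and `iter` demand `Finite` types. -/
theorem finite_label : {α : Type} → (c : Cmd W Sym α) → Finite c.Label
  | _, pure _ => inferInstanceAs (Finite Unit)
  | _, pop _ => inferInstanceAs (Finite Unit)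
  | _, push _ _ => inferInstanceAs (Finite Unit)
  | _, @bind _ _ α _ _ c f =>
    have := c.finite_label
    have := fun a => (f a).finite_label
    inferInstanceAs (Finite (c.Label ⊕ Σ a : α, (f a).Label))
  | _, @iter _ _ τ _ _ f _ =>
    have := fun t => (f t).finite_label
    inferInstanceAs (Finite (Σ t : τ, (f t).Label))

/-- The stacks of the compiled machine: an output stack, an input stack, and the stacks of the
program. -/
abbrev StackAlphabet (W Sym : Type) : Option (Option W) → Type
  | none => Bool
  | some none => Option Bool
  | some (some _) => Sym

/-- The code of the compiled program at a label: `emb` embeds the labels into those of the whole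
machine, and `κ` is the label at which the machine continues, given the returned value. -/
def code {Λ : Type} : {α : Type} → (c : Cmd W Sym α) → (emb : c.Label → Λ) → (κ : α → Λ) →
    c.Label → TM2.Stmt (StackAlphabet W Sym) Λ (Option Sym)
  | _, pure a, _, κ, _ => .goto fun _ => κ a
  | _, pop k, _, κ, _ => .pop (some (some k)) (fun _ x => x) (.goto fun x => κ x)
  | _, push k s, _, κ, _ => .push (some (some k)) (fun _ => s) (.goto fun _ => κ ())
  | _, bind c f, emb, κ, l =>
    match l with
    | Sum.inl l => c.code (fun l => emb (Sum.inl l)) (fun a => emb (Sum.inr ⟨a, (f a).entry⟩)) l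
    | Sum.inr ⟨a, l⟩ => (f a).code (fun l => emb (Sum.inr ⟨a, l⟩)) κ l
  | _, iter f _, emb, κ, l =>
    match l with
    | ⟨t, l⟩ => (f t).code (fun l => emb ⟨t, l⟩)
        (Sum.elim (fun t' => emb ⟨t', (f t').entry⟩) κ) l

/-! ### Big-step semantics with a space bound -/

section Runs

variable [Fintype W] [DecidableEq W]

/-- The number of symbols on all stacks. -/
def size (S : W → List Sym) : ℕ := ∑ k, (S k).length

/-- `Runs B c S a S'`: started on the stacks `S`, the program `c` returns `a` and leaves the stacks
`S'`, and there are at most `B` symbols on the stacks all the time. -/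
inductive Runs (B : ℕ) : {α : Type} → Cmd W Sym α → (W → List Sym) → α → (W → List Sym) → Prop
  | pure {α : Type} {a : α} {S} (h : size S ≤ B) : Runs B (pure a) S a S
  | pop {k : W} {S} (h : size S ≤ B) :
      Runs B (pop k) S (S k).head? (Function.update S k (S k).tail)
  | push {k : W} {s : Sym} {S} (h : size S + 1 ≤ B) :
      Runs B (push k s) S () (Function.update S k (s :: S k))
  | bind {α β : Type} [Finite α] {c : Cmd W Sym α} {f : α → Cmd W Sym β} {S S' S'' a b}
      (h₁ : Runs B c S a S') (h₂ : Runs B (f a) S' b S'') : Runs B (bind c f) S b S''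
  | next {τ β : Type} [Finite τ] {f : τ → Cmd W Sym (τ ⊕ β)} {t t' S S' S'' b}
      (h₁ : Runs B (f t) S (Sum.inl t') S') (h₂ : Runs B (iter f t') S' b S'') :
      Runs B (iter f t) S b S''
  | exit {τ β : Type} [Finite τ] {f : τ → Cmd W Sym (τ ⊕ β)} {t S S' b}
      (h : Runs B (f t) S (Sum.inr b) S') : Runs B (iter f t) S b S'

theorem size_update (S : W → List Sym) (k : W) (l : List Sym) :
    size (Function.update S k l) + (S k).length = size S + l.length := by
  unfold size
  rw [← Finset.add_sum_erase _ _ (Finset.mem_univ k),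
    ← Finset.add_sum_erase (a := k) _ (fun j => (S j).length) (Finset.mem_univ k)]
  have : ∑ x ∈ Finset.univ.erase k, (Function.update S k l x).length =
      ∑ x ∈ Finset.univ.erase k, (S x).length :=
    Finset.sum_congr rfl fun x hx => by
      rw [Function.update_of_ne (Finset.ne_of_mem_erase hx)]
  rw [this, Function.update_self]
  omega

theorem Runs.size_le {B : ℕ} {α : Type} {c : Cmd W Sym α} {S S' a} (h : Runs B c S a S') :
    size S ≤ B ∧ size S' ≤ B := by
  induction h with
  | pure h => exact ⟨h, h⟩
  | @pop k S h =>
    have := size_update S k (S k).tail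
    rw [List.length_tail] at this
    exact ⟨h, by omega⟩
  | @push k s S h =>
    have := size_update S k (s :: S k)
    rw [List.length_cons] at this
    exact ⟨by omega, by omega⟩
  | bind _ _ ih₁ ih₂ => exact ⟨ih₁.1, ih₂.2⟩
  | next _ _ ih₁ ih₂ => exact ⟨ih₁.1, ih₂.2⟩
  | exit _ ih => exact ih

/-- Rules of `Runs` produce nested `Function.update`s; this lets the result be replaced by an equal,
readable one. -/
theorem Runs.cast {B : ℕ} {α : Type} {c : Cmd W Sym α} {S S₁ S₂ : W → List Sym} {a b : α}
    (h : Runs B c S a S₁) (hab : a = b) (hS : S₁ = S₂) : Runs B c S b S₂ :=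
  hab ▸ hS ▸ h

end Runs

/-! ### Compilation -/

section Compile

variable [DecidableEq W]

/-- The stacks of the compiled machine. -/
def machineStacks (i : List (Option Bool)) (S : W → List Sym) : ∀ k, List (StackAlphabet W Sym k)
  | none => []
  | some none => i
  | some (some k) => S k

theorem update_stacks (i : List (Option Bool)) (S : W → List Sym) (k : W) (l : List Sym) :
    Function.update (machineStacks i S) (some (some k)) l = machineStacks i (Function.update S k l) := by
  funext j
  rcases j with _ | _ | j
  · rw [Function.update_of_ne (by simp)]; rfl
  · rw [Function.update_of_ne (by simp)]; rfl
  · by_cases h : j = k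
    · subst h
      simp [machineStacks]
    · rw [Function.update_of_ne (by simpa using h)]
      simp [machineStacks, h]

theorem update_stacks_input (i j : List (Option Bool)) (S : W → List Sym) :
    Function.update (machineStacks i S) (some none) j = machineStacks j S := by
  funext k
  rcases k with _ | _ | k
  · rw [Function.update_of_ne (by simp)]; rfl
  · rw [Function.update_self]; rfl
  · rw [Function.update_of_ne (by simp)]; rfl

variable [Fintype W]

/-- The number of symbols on all stacks of the compiled machine. -/
def cfgSize {Λ σ : Type} (c : TM2.Cfg (StackAlphabet W Sym) Λ σ) : ℕ := ∑ k, (c.stk k).length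

omit [DecidableEq W] in
theorem cfgSize_stacks {Λ σ : Type} (l : Option Λ) (v : σ) (i : List (Option Bool))
    (S : W → List Sym) :
    cfgSize (⟨l, v, machineStacks i S⟩ : TM2.Cfg (StackAlphabet W Sym) Λ σ) = i.length + size S := by
  simp [cfgSize, machineStacks, Fintype.sum_option, size]

/-- One step of the machine from a configuration of size at most `B`. -/
def BStep {Λ : Type} (M : Λ → TM2.Stmt (StackAlphabet W Sym) Λ (Option Sym)) (B : ℕ)
    (c c' : TM2.Cfg (StackAlphabet W Sym) Λ (Option Sym)) : Prop :=
  TM2.step M c = some c' ∧ cfgSize c ≤ B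

/-- Induction on the run. `emb` and `κ` stay general because each subprogram sits in the machine
through its own embedding and continuation. The internal state is only a register for the last
popped symbol, so its initial value is arbitrary and its final value is not tracked. -/
theorem Runs.exists_path {Λ : Type} {M : Λ → TM2.Stmt (StackAlphabet W Sym) Λ (Option Sym)}
    {B : ℕ} {α : Type} {c : Cmd W Sym α} {S S' : W → List Sym} {a : α} (h : Runs B c S a S') :
    ∀ (emb : c.Label → Λ) (κ : α → Λ), (∀ l, M (emb l) = c.code emb κ l) → ∀ v, ∃ v',
      ReflTransGen (BStep M B) ⟨some (emb c.entry), v, machineStacks [] S⟩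
        ⟨some (κ a), v', machineStacks [] S'⟩ := by
  induction h with
  | pure h =>
    intro emb κ hM v
    refine ⟨v, .single ⟨?_, by simpa [cfgSize_stacks] using h⟩⟩
    rw [TM2.step, hM]
    rfl
  | @pop k S h =>
    intro emb κ hM v
    refine ⟨(S k).head?, .single ⟨?_, by simpa [cfgSize_stacks] using h⟩⟩
    rw [TM2.step, hM, ← update_stacks]
    rfl
  | @push k s S h =>
    intro emb κ hM v
    refine ⟨v, .single ⟨?_, by simp only [cfgSize_stacks, List.length_nil]; omega⟩⟩
    rw [TM2.step, hM, ← update_stacks]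
    rfl
  | @bind _ _ _ c f _ _ _ a b _ _ ih₁ ih₂ =>
    intro emb κ hM v
    obtain ⟨v₁, h₁⟩ := ih₁ (fun l => emb (Sum.inl l))
      (fun a => emb (Sum.inr ⟨a, (f a).entry⟩)) (fun l => hM (Sum.inl l)) v
    obtain ⟨v₂, h₂⟩ := ih₂ (fun l => emb (Sum.inr ⟨a, l⟩)) κ (fun l => hM (Sum.inr ⟨a, l⟩)) v₁
    exact ⟨v₂, h₁.trans h₂⟩
  | @next _ _ _ f t t' _ _ _ b _ _ ih₁ ih₂ =>
    intro emb κ hM v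
    obtain ⟨v₁, h₁⟩ := ih₁ (fun l => emb ⟨t, l⟩)
      (Sum.elim (fun t' => emb ⟨t', (f t').entry⟩) κ) (fun l => hM ⟨t, l⟩) v
    obtain ⟨v₂, h₂⟩ := ih₂ emb κ hM v₁
    exact ⟨v₂, h₁.trans h₂⟩
  | @exit _ _ _ f t _ _ b _ ih =>
    intro emb κ hM v
    exact ih (fun l => emb ⟨t, l⟩) (Sum.elim (fun t' => emb ⟨t', (f t').entry⟩) κ)
      (fun l => hM ⟨t, l⟩) v

/-- The machine is deterministic and `b` is halting, so every configuration reachable from `a` lies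
on the given path. -/
theorem cfgSize_le_of_reaches {Λ : Type}
    {M : Λ → TM2.Stmt (StackAlphabet W Sym) Λ (Option Sym)} {B : ℕ}
    {a b : TM2.Cfg (StackAlphabet W Sym) Λ (Option Sym)}
    (h : ReflTransGen (BStep M B) a b) (hb : TM2.step M b = none) (hB : cfgSize b ≤ B) :
    ∀ c, Reaches (TM2.step M) a c → cfgSize c ≤ B := by
  induction h using ReflTransGen.head_induction_on with
  | refl =>
    intro c hc
    rcases hc.cases_head with rfl | ⟨d, hd, -⟩
    · exact hB
    · rw [hb] at hd
      simp at hd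
  | head h₁ _ ih =>
    intro c hc
    rcases hc.cases_head with rfl | ⟨d, hd, hdc⟩
    · exact h₁.2
    · rw [Option.mem_def, h₁.1, Option.some.injEq] at hd
      exact ih c (hd ▸ hdc)

theorem nonempty_evalsTo {Λ : Type}
    {M : Λ → TM2.Stmt (StackAlphabet W Sym) Λ (Option Sym)} {B : ℕ}
    {a b : TM2.Cfg (StackAlphabet W Sym) Λ (Option Sym)}
    (h : ReflTransGen (BStep M B) a b) : Nonempty (EvalsTo (TM2.step M) a (some b)) := by
  induction h with
  | refl => exact ⟨EvalsTo.refl _ _⟩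
  | tail _ h ih =>
    obtain ⟨ih⟩ := ih
    exact ⟨ih.trans _ _ _ _ ⟨1, h.1⟩⟩

/-- The labels of the machine that loads its input, runs a program, and gives the answer. -/
inductive MachineLabel (c : Cmd W Sym Bool) : Type
  | load : MachineLabel c
  | run (l : c.Label) : MachineLabel c
  | answer (b : Bool) : MachineLabel c

omit [DecidableEq W] [Fintype W] in
theorem finite_machineLabel (c : Cmd W Sym Bool) : Finite (MachineLabel c) := by
  have := c.finite_label
  refine Finite.of_injective (β := Option (c.Label ⊕ Bool))
    (fun l => match l with
      | .load => none
      | .run l => some (Sum.inl l)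
      | .answer b => some (Sum.inr b)) ?_
  rintro (_ | _ | _) (_ | _ | _) h <;> simp_all

/-- The code of the machine that moves its input to the stack `k₀`, which reverses it, runs the
program `c`, and gives the answer. -/
def machineCode (conv : Option Bool → Sym) (k₀ : W) (c : Cmd W Sym Bool) :
    MachineLabel c → TM2.Stmt (StackAlphabet W Sym) (MachineLabel c) (Option Sym)
  | .load => .pop (some none) (fun _ x => x.map conv)
      (.branch Option.isSome
        (.push (some (some k₀)) (fun x => x.getD (conv none)) (.goto fun _ => .load))
        (.goto fun _ => .run c.entry))
  | .run l => c.code .run .answer l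
  | .answer b => .push none (fun _ => b) (.load (fun _ => none) .halt)

/-- Each round moves one symbol between stacks, so the total size is constant during loading. -/
theorem load_path (conv : Option Bool → Sym) (k₀ : W) (c : Cmd W Sym Bool) (B : ℕ)
    (w : List (Option Bool)) : ∀ (S : W → List Sym) (v : Option Sym), w.length + size S ≤ B →
      ReflTransGen (BStep (machineCode conv k₀ c) B) ⟨some .load, v, machineStacks w S⟩
        ⟨some (.run c.entry), none,
          machineStacks [] (Function.update S k₀ ((w.map conv).reverse ++ S k₀))⟩ := by
  induction w with
  | nil =>
    intro S v h
    refine .single ⟨?_, by rwa [cfgSize_stacks]⟩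
    rw [TM2.step, machineCode, TM2.stepAux, TM2.stepAux]
    simp [machineStacks, -Function.update_eq_self_iff]
    exact update_stacks_input _ _ _
  | cons x w ih =>
    intro S v h
    have hs := size_update S k₀ (conv x :: S k₀)
    rw [List.length_cons] at h hs
    refine .head ⟨?_, by rwa [cfgSize_stacks]⟩
      ((ih (Function.update S k₀ (conv x :: S k₀)) (some (conv x)) (by omega)).trans ?_)
    · have e : Function.update (machineStacks (x :: w) S) (some none)
          (machineStacks (x :: w) S (some none)).tail = machineStacks w S :=
        update_stacks_input _ _ _
      rw [TM2.step, machineCode, TM2.stepAux, e, ← update_stacks]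
      rfl
    · simp
      rfl

/-- A language is in `PSPACE` if it is decided by a program in polynomial space. -/
theorem mem_PSPACE [Finite Sym] (conv : Option Bool → Sym) (k₀ : W) (c : Cmd W Sym Bool)
    (p : Polynomial ℕ) (L : Language (Option Bool))
    (h : ∀ (w : List (Option Bool)) (b : Bool), (b = true ↔ w ∈ L) →
      Runs (p.eval w.length) c (Function.update (fun _ => []) k₀ (w.map conv).reverse) b
        fun _ => []) :
    L ∈ PSPACE (Option Bool) := by
  have := c.finite_machineLabel
  classical
  let tm : FinTM2 :=
    { K := Option (Option W)
      kDecidableEq := inferInstance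
      kFin := inferInstance
      k₀ := some none
      k₁ := none
      Γ := StackAlphabet W Sym
      Λ := MachineLabel c
      main := .load
      ΛFin := Fintype.ofFinite _
      σ := Option Sym
      initialState := none
      σFin := Fintype.ofFinite _
      Γk₀Fin := inferInstanceAs (Fintype (Option Bool))
      m := machineCode conv k₀ c }
  -- Beyond the space of the program, `w.length` pays for loading the input and `1` for the answer
  -- bit.
  have path : ∀ (w : List (Option Bool)) (b : Bool), (b = true ↔ w ∈ L) →
      ReflTransGen (BStep (machineCode conv k₀ c) (p.eval w.length + 1 + w.length))
        ⟨some .load, none, machineStacks w fun _ => []⟩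
        ⟨none, none, Function.update (machineStacks [] fun _ => []) none [b]⟩ := by
    intro w b hb
    refine (load_path conv k₀ c _ w (fun _ => []) none (by simp [size])).trans ?_
    obtain ⟨v, hv⟩ := (h w b hb).exists_path (M := machineCode conv k₀ c) .run .answer
      (fun l => rfl) none
    refine .tail (b := ⟨some (.answer b), v, machineStacks [] fun _ => []⟩) ?_
      ⟨rfl, by simp [cfgSize_stacks, size]⟩
    simp only [List.append_nil]
    exact hv.lift id fun _ _ h => ⟨h.1, h.2.trans (by omega)⟩
  have init : ∀ w : List (Option Bool), initList tm w = ⟨some .load, none, machineStacks w fun _ => []⟩ := by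
    intro w
    unfold initList
    congr 1
    funext k
    rcases k with _ | _ | k <;> rfl
  have halt : ∀ b : Bool, haltList tm [b] =
      ⟨none, none, Function.update (machineStacks [] fun _ => []) none [b]⟩ := by
    intro b
    unfold haltList
    congr 1
    funext k
    rcases k with _ | _ | k <;> rfl
  refine ⟨{ tm := tm
            inputAlphabet := Equiv.refl _
            outputAlphabet := Equiv.refl _
            alphabetFinite := ?_
            space := p + 1 + Polynomial.X
            outputs := fun w b hb => Classical.choice ?_
            space_le := ?_ }⟩
  · rintro (_ | _ | k)
    · exact inferInstanceAs (Finite Bool)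
    · exact inferInstanceAs (Finite (Option Bool))
    · exact inferInstanceAs (Finite Sym)
  · have := nonempty_evalsTo (path w b hb)
    rw [← init, ← halt] at this
    have e : w.map (Equiv.refl (tm.Γ tm.k₀)).invFun = w := List.map_id w
    rw [e]
    exact this
  · intro w d hd
    have e : w.map (Equiv.refl (tm.Γ tm.k₀)).invFun = w := List.map_id w
    rw [e, init] at hd
    have := cfgSize_le_of_reaches (path w (decide (w ∈ L)) (by simp)) rfl ?_ d hd
    · refine le_of_eq_of_le ?_ (this.trans_eq (by simp))
      exact Finset.sum_congr (by congr) fun _ _ => rfl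
    · simp [cfgSize, Fintype.sum_option, machineStacks]
      omega

end Compile

end Cmd

/-! ### Backward induction on the game -/

namespace PathGame

variable {G : PathGame}

/-- The traveler can force a win from a position. -/
inductive Win : G.Position → Prop
  | target {p : G.Position} (h : p.vertex = G.z) : Win p
  | move {p : G.Position} {e : TimeArc G.n} (h : G.Available p e) (hf : Win (G.next p (e, false)))
      (ht : 0 < p.budget → Win (G.next p (e, true))) : Win p

theorem win_iff {p : G.Position} : Win p ↔ p.vertex = G.z ∨ ∃ e, G.Available p e ∧
    Win (G.next p (e, false)) ∧ (0 < p.budget → Win (G.next p (e, true))) := by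
  constructor
  · rintro (h | ⟨h, hf, ht⟩)
    · exact .inl h
    · exact .inr ⟨_, h, hf, ht⟩
  · rintro (h | ⟨e, h, hf, ht⟩)
    · exact .target h
    · exact .move h hf ht

theorem position_append (h : List G.Round) (r : G.Round) :
    G.position (h ++ [r]) = G.next (G.position h) r := by
  simp [position]

/-- The number of vertices that have not been visited. -/
def Position.unvisited (p : G.Position) : ℕ := p.visitedᶜ.card

/-- The termination measure behind both inductions on the game, for strategies and for the search.
-/
theorem Available.unvisited_next_lt {p : G.Position} {e : TimeArc G.n} (h : G.Available p e)
    (d : Bool) : (G.next p (e, d)).unvisited < p.unvisited := by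
  refine Finset.card_lt_card (Finset.compl_ssubset_compl.2 ?_)
  exact Finset.ssubset_insert h.2.2.2

-- If the start is not in `Win`, the adversary delays exactly when a delay is left and the delayed
-- successor is not in `Win`; then no position of the play is in `Win`, so `z` is never reached.
-- Conversely, the traveler always chooses an arc that stays in `Win` under both replies, and the
-- shrinking number of unvisited vertices forces the play to end at `z`.
open Classical in
theorem travelerWins_iff : G.TravelerWins ↔ Win G.start := by
  constructor
  · rintro ⟨σ, hσ⟩
    by_contra hs
    let τ : G.AdversaryStrategy := fun h e =>
      decide (0 < (G.position h).budget ∧ ¬ Win (G.next (G.position h) (e, true)))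
    obtain ⟨h, hp, hz⟩ := hσ τ fun h e he => (of_decide_eq_true he).1
    have key : ∀ h, G.Play σ τ h → ¬ Win (G.position h) := by
      intro h hp
      induction hp with
      | start => exact hs
      | @round h _ _ ha ih =>
        rw [position_append]
        by_cases hc : 0 < (G.position h).budget ∧ ¬ Win (G.next (G.position h) (σ h, true))
        · rw [show τ h (σ h) = true from decide_eq_true hc]
          exact hc.2
        · rw [show τ h (σ h) = false from decide_eq_false hc]
          intro hf
          exact ih (.move ha hf fun hb => by_contra fun ht => hc ⟨hb, ht⟩)
    exact key h hp (.target hz)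
  · intro hs
    let good (h : List G.Round) (e : TimeArc G.n) : Prop :=
      G.Available (G.position h) e ∧ Win (G.next (G.position h) (e, false)) ∧
        (0 < (G.position h).budget → Win (G.next (G.position h) (e, true)))
    let σ : G.TravelerStrategy := fun h =>
      -- The default arc is irrelevant: a winning position other than `z` always has a good arc.
      if hw : ∃ e, good h e then hw.choose else ⟨G.s, G.s, 0, 0⟩
    refine ⟨σ, fun τ hτ => ?_⟩
    have key : ∀ m h, (G.position h).unvisited ≤ m → G.Play σ τ h → Win (G.position h) →
        ∃ h, G.Play σ τ h ∧ (G.position h).vertex = G.z := by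
      intro m
      induction m with
      | zero =>
        intro h hm hp hw
        rcases win_iff.1 hw with hz | ⟨e, ha, -⟩
        · exact ⟨h, hp, hz⟩
        · have := ha.unvisited_next_lt false
          omega
      | succ m ih =>
        intro h hm hp hw
        by_cases hz : (G.position h).vertex = G.z
        · exact ⟨h, hp, hz⟩
        have hg : ∃ e, good h e := (win_iff.1 hw).resolve_left hz
        have hσ : good h (σ h) := by
          simp only [σ, dif_pos hg]
          exact hg.choose_spec
        refine ih (h ++ [(σ h, τ h (σ h))]) ?_ (.round hp hz hσ.1) ?_
        · rw [position_append]
          have := hσ.1.unvisited_next_lt (τ h (σ h))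
          omega
        · rw [position_append]
          by_cases hd : τ h (σ h) = true
          · rw [hd]
            exact hσ.2.2 (hτ _ _ hd)
          · rw [Bool.not_eq_true] at hd
            rw [hd]
            exact hσ.2.1
    exact key _ [] le_rfl .start hs

end PathGame

/-! ### Binary counters -/

/-- The value of a binary number, least significant bit first. -/
def bitsValue : List Bool → ℕ
  | [] => 0
  | b :: l => b.toNat + 2 * bitsValue l

/-- Passes the carry `c` through a binary counter: decrement for `b = false`, increment for
`b = true`. The second component is the carry that is left at the end. -/
def bump (b : Bool) : Bool → List Bool → List Bool × Bool
  | c, [] => ([], c)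
  | c, x :: l => ((x ^^ c) :: (bump b (c && (x == b)) l).1, (bump b (c && (x == b)) l).2)

theorem bump_false (b : Bool) (l : List Bool) : bump b false l = (l, false) := by
  induction l with
  | nil => rfl
  | cons x l ih => simp [bump, ih]

theorem length_bump (b c : Bool) (l : List Bool) : (bump b c l).1.length = l.length := by
  induction l generalizing c with
  | nil => rfl
  | cons x l ih => simp [bump, ih]

/-- Holds for zero as well, where the decrement wraps around to all ones. Hence even a failed
decrement can be undone, and returning from a delayed arc restores the budget bit for bit. -/
theorem increment_decrement (l : List Bool) : (bump true true (bump false true l).1).1 = l := by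
  induction l with
  | nil => rfl
  | cons x l ih => cases x <;> simp [bump, ih, bump_false]

/-- The borrow survives to the end only past zeros, so a decrement doubles as a test for an empty
budget. -/
theorem decrement_carry_iff (l : List Bool) : (bump false true l).2 = true ↔ bitsValue l = 0 := by
  induction l with
  | nil => simp [bump, bitsValue]
  | cons x l ih => cases x <;> simp [bump, ih, bump_false, bitsValue]

theorem bitsValue_decrement (l : List Bool) (h : bitsValue l ≠ 0) :
    bitsValue (bump false true l).1 = bitsValue l - 1 := by
  induction l with
  | nil => simp [bitsValue] at h
  | cons x l ih =>
    cases x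
    · have : bitsValue l ≠ 0 := by simpa [bitsValue] using h
      simp [bump, bitsValue, ih this]
      omega
    · simp [bump, bitsValue, bump_false]

/-! ### Depth-first search of the game tree -/

namespace PathGame

open Relation

variable {G : PathGame}

/-- What the search does next: look at the current position, scan the arcs for the next move of
the traveler, or return from the current position with an answer. -/
inductive Mode : Type
  | down : Mode
  | scan : Mode
  | ret (b : Bool) : Mode

/-- A round that is being explored: whether the arc is delayed, the arc, and the arcs that have not
been tried yet. -/
abbrev Frame (n : ℕ) : Type := Bool × TimeArc n × List (TimeArc n)

/-- The position after the rounds in a list of frames, the last round first. -/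
def framesPosition (G : PathGame) (fr : List (Frame G.n)) : G.Position :=
  fr.foldr (fun f p => G.next p (f.2.1, f.1)) G.start

/-- A state of the search. -/
structure Search (n : ℕ) where
  /-- what to do next -/
  mode : Mode
  /-- the arcs that remain to be scanned -/
  cur : List (TimeArc n)
  /-- the rounds that lead to the current position, the last one first -/
  frames : List (Frame n)
  /-- the remaining budget of the adversary, in binary -/
  budget : List Bool

/-- The conditions of `PathGame.Available` except that `e` is an arc. -/
def Admissible (p : G.Position) (e : TimeArc G.n) : Prop :=
  e.src = p.vertex ∧ p.time ≤ e.time ∧ e.dst ∉ p.visited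

/-- The state after leaving a position with the answer `b`. -/
def back (b : Bool) {n : ℕ} (rest : List (TimeArc n)) (fr : List (Frame n)) (β : List Bool) :
    Search n :=
  if b then ⟨.ret true, [], fr, β⟩ else ⟨.scan, rest, fr, β⟩

open Classical in
/-- One step of the search, where `l` lists the arcs. -/
noncomputable def searchStep (l : List (TimeArc G.n)) : Search G.n → Search G.n
  | ⟨.down, cur, fr, β⟩ =>
    if (framesPosition G fr).vertex = G.z then ⟨.ret true, cur, fr, β⟩ else ⟨.scan, l, fr, β⟩
  | ⟨.scan, [], fr, β⟩ => ⟨.ret false, [], fr, β⟩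
  | ⟨.scan, e :: rest, fr, β⟩ =>
    if Admissible (framesPosition G fr) e then ⟨.down, [], (false, e, rest) :: fr, β⟩
    else ⟨.scan, rest, fr, β⟩
  | ⟨.ret b, cur, [], β⟩ => ⟨.ret b, cur, [], β⟩
  | ⟨.ret b, _, (true, _, rest) :: fr, β⟩ => back b rest fr (bump true true β).1
  | ⟨.ret false, _, (false, _, rest) :: fr, β⟩ => back false rest fr β
  | ⟨.ret true, _, (false, e, rest) :: fr, β⟩ =>
    if (bump false true β).2 then back true rest fr β
    else ⟨.down, [], (true, e, rest) :: fr, (bump false true β).1⟩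

/-- The invariant of the search. -/
structure Search.Valid (l : List (TimeArc G.n)) (k : ℕ) (s : Search G.n) : Prop where
  cur_suffix : s.cur <:+ l
  cur_eq_nil : s.mode ≠ .scan → s.cur = []
  frames_suffix : ∀ f ∈ s.frames, f.2.1 :: f.2.2 <:+ l
  nodup : (s.frames.map fun f => f.2.1.dst).Nodup
  length_budget : s.budget.length = k

/-- The end vertices on the branch form a duplicate-free list drawn from the end vertices of `l`. A
bound by `G.n` would not do, since `G.n` is given in binary. -/
theorem Search.Valid.length_frames_le {l : List (TimeArc G.n)} {k : ℕ} {s : Search G.n}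
    (h : s.Valid l k) : s.frames.length ≤ l.length := by
  have : (s.frames.map fun f => f.2.1.dst) ⊆ l.map TimeArc.dst := by
    intro v hv
    obtain ⟨f, hf, rfl⟩ := List.mem_map.1 hv
    exact List.mem_map_of_mem ((h.frames_suffix f hf).subset List.mem_cons_self)
  simpa using (h.nodup.subperm this).length_le

/-- A step of the search from a valid state that is not final. -/
def ValidStep (l : List (TimeArc G.n)) (k : ℕ) (s s' : Search G.n) : Prop :=
  s.Valid l k ∧ (∀ b, s.mode = .ret b → s.frames ≠ []) ∧ searchStep l s = s'

/-- The visited set needs no storage of its own: it is recovered from the branch. -/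
theorem visited_framesPosition (fr : List (Frame G.n)) (v : Fin G.n) :
    v ∈ (framesPosition G fr).visited ↔ v = G.s ∨ ∃ f ∈ fr, f.2.1.dst = v := by
  induction fr with
  | nil => simp [framesPosition, start]
  | cons f fr ih =>
    simp only [framesPosition, List.foldr_cons, next, Finset.mem_insert, List.mem_cons,
      exists_eq_or_imp] at ih ⊢
    rw [ih]
    tauto

/-! ### Correctness of the search -/

variable {l : List (TimeArc G.n)} {k : ℕ}

/-- The frames of a valid search. -/
def ValidFrames (l : List (TimeArc G.n)) (fr : List (Frame G.n)) : Prop :=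
  (∀ f ∈ fr, f.2.1 :: f.2.2 <:+ l) ∧ (fr.map fun f => f.2.1.dst).Nodup

theorem ValidFrames.valid {fr : List (Frame G.n)} {β : List Bool} (h : ValidFrames l fr)
    (hβ : β.length = k) (m : Mode) : (Search.mk m [] fr β).Valid l k :=
  ⟨List.nil_suffix, fun _ => rfl, h.1, h.2, hβ⟩

theorem ValidFrames.valid_scan {fr : List (Frame G.n)} {β : List Bool} (h : ValidFrames l fr)
    (hβ : β.length = k) {cur : List (TimeArc G.n)} (hc : cur <:+ l) :
    (Search.mk .scan cur fr β).Valid l k :=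
  ⟨hc, fun h => absurd rfl h, h.1, h.2, hβ⟩

theorem ValidFrames.cons {fr : List (Frame G.n)} (h : ValidFrames l fr) {e : TimeArc G.n}
    {rest : List (TimeArc G.n)} (hs : e :: rest <:+ l)
    (he : Admissible (framesPosition G fr) e) (d : Bool) : ValidFrames l ((d, e, rest) :: fr) := by
  refine ⟨?_, ?_⟩
  · intro f hf
    rcases List.mem_cons.1 hf with rfl | hf
    · exact hs
    · exact h.1 f hf
  · rw [List.map_cons, List.nodup_cons]
    refine ⟨fun hm => he.2.2 ?_, h.2⟩
    obtain ⟨f, hf, hfe⟩ := List.mem_map.1 hm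
    exact (visited_framesPosition fr _).2 (.inr ⟨f, hf, hfe⟩)

/-- The traveler can win by choosing the arc `e`. -/
def WinsBy (p : G.Position) (e : TimeArc G.n) : Prop :=
  Admissible p e ∧ Win (G.next p (e, false)) ∧ (0 < p.budget → Win (G.next p (e, true)))

open Classical in
/-- The search computes the outcome at every position, if it does so for the positions with fewer
unvisited vertices. -/
theorem search_scan {fr : List (Frame G.n)} {β : List Bool} (hfr : ValidFrames l fr)
    (hβ : β.length = k) (hv : bitsValue β = (framesPosition G fr).budget)
    (ih : ∀ d e rest β, ValidFrames l ((d, e, rest) :: fr) → β.length = k →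
      Admissible (framesPosition G fr) e → 
      bitsValue β = (framesPosition G ((d, e, rest) :: fr)).budget →
      ReflTransGen (ValidStep l k) ⟨.down, [], (d, e, rest) :: fr, β⟩
        ⟨.ret (decide (Win (framesPosition G ((d, e, rest) :: fr)))), [],
          (d, e, rest) :: fr, β⟩) (cur : List (TimeArc G.n)) (hc : cur <:+ l) :
    ReflTransGen (ValidStep l k) ⟨.scan, cur, fr, β⟩
      ⟨.ret (decide (∃ e ∈ cur, WinsBy (framesPosition G fr) e)), [], fr, β⟩ := by
  induction cur with
  | nil =>
    refine .single ⟨hfr.valid_scan hβ hc, by simp, ?_⟩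
    simp [searchStep]
  | cons e rest ihc =>
    have hc' : rest <:+ l := (List.suffix_cons e rest).trans hc
    have ihc := ihc hc'
    have hskip : ¬ WinsBy (framesPosition G fr) e →
        decide (∃ e ∈ rest, WinsBy (framesPosition G fr) e) =
        decide (∃ e' ∈ e :: rest, WinsBy (framesPosition G fr) e') := by
      intro h
      simp [h]
    have hwin : WinsBy (framesPosition G fr) e →
        true = decide (∃ e' ∈ e :: rest, WinsBy (framesPosition G fr) e') := by
      intro h
      simp [h]
    by_cases ha : Admissible (framesPosition G fr) e
    swap
    · rw [← hskip fun h => ha h.1]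
      refine .head ⟨hfr.valid_scan hβ hc, by simp, ?_⟩ ihc
      simp [searchStep, ha]
    have hf (d : Bool) : ValidFrames l ((d, e, rest) :: fr) := hfr.cons hc ha d
    have hvf : bitsValue β = (framesPosition G ((false, e, rest) :: fr)).budget := hv
    refine .head (b := ⟨.down, [], (false, e, rest) :: fr, β⟩)
      ⟨hfr.valid_scan hβ hc, by simp, by simp [searchStep, ha]⟩ ?_
    refine (ih false e rest β (hf false) hβ ha hvf).trans ?_
    have hn (d : Bool) : framesPosition G ((d, e, rest) :: fr) =
      G.next (framesPosition G fr) (e, d) := rfl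
    rw [hn]
    by_cases hwf : Win (G.next (framesPosition G fr) (e, false))
    swap
    · rw [← hskip fun h => hwf h.2.1]
      refine .head ⟨(hf _).valid hβ _, by simp, ?_⟩ ihc
      simp [searchStep, hwf, back]
    rw [decide_eq_true hwf]
    -- With no delay left, the undelayed win already settles the arc; the search sees this from the
    -- surviving borrow and keeps `β`.
    by_cases hb : bitsValue β = 0
    · have := (decrement_carry_iff β).2 hb
      rw [← hwin ⟨ha, hwf, fun h => by omega⟩]
      refine .single ⟨(hf _).valid hβ _, by simp, ?_⟩
      simp [searchStep, this, back]
    have hdec : (bump false true β).2 = false := by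
      rw [← Bool.not_eq_true, decrement_carry_iff]
      exact hb
    have hβ' : (bump false true β).1.length = k := by rw [length_bump, hβ]
    -- Otherwise the same arc is explored a second time as delayed, with one delay spent.
    refine .head (b := ⟨.down, [], (true, e, rest) :: fr, (bump false true β).1⟩)
      ⟨(hf _).valid hβ _, by simp, by simp [searchStep, hdec]⟩ ?_
    refine (ih true e rest _ (hf true) hβ' ha ?_).trans ?_
    · rw [bitsValue_decrement _ hb, hv]
      rfl
    rw [hn]
    by_cases hwt : Win (G.next (framesPosition G fr) (e, true))
    · rw [← hwin ⟨ha, hwf, fun h => hwt⟩]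
      refine .single ⟨(hf _).valid hβ' _, by simp, ?_⟩
      simp [searchStep, hwt, back, increment_decrement]
    · rw [← hskip fun h => hwt (h.2.2 (by omega))]
      refine .head ⟨(hf _).valid hβ' _, by simp, ?_⟩ ihc
      simp [searchStep, hwt, back, increment_decrement]

open Classical in
/-- The search computes the outcome at every position. -/
theorem search_down (hl : ∀ e, e ∈ l ↔ e ∈ G.arcs) (m : ℕ) : ∀ (fr : List (Frame G.n))
    (β : List Bool), (framesPosition G fr).unvisited < m → ValidFrames l fr → β.length = k →
    bitsValue β = (framesPosition G fr).budget →
    ReflTransGen (ValidStep l k) ⟨.down, [], fr, β⟩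
      ⟨.ret (decide (Win (framesPosition G fr))), [], fr, β⟩ := by
  induction m with
  | zero => intro fr β hm; omega
  | succ m ih =>
    intro fr β hm hfr hβ hv
    by_cases hz : (framesPosition G fr).vertex = G.z
    · rw [decide_eq_true (Win.target hz)]
      exact .single ⟨hfr.valid hβ _, by simp, by simp [searchStep, hz]⟩
    refine .head (b := ⟨.scan, l, fr, β⟩) ⟨hfr.valid hβ _, by simp, by simp [searchStep, hz]⟩ ?_
    have := search_scan hfr hβ hv (fun d e rest β hf hβ ha hv => ih _ β (by
      have h : G.Available (framesPosition G fr) e :=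
        ⟨(hl e).1 ((hf.1 _ List.mem_cons_self).subset List.mem_cons_self), ha⟩
      have := h.unvisited_next_lt d
      change (G.next (framesPosition G fr) (e, d)).unvisited < m
      omega) hf hβ hv) l List.suffix_rfl
    -- Away from `z`, winning means winning by some arc of `l`, which is what the scan computes.
    convert this using 5
    rw [win_iff]
    refine or_iff_right hz |>.trans ⟨?_, ?_⟩
    · rintro ⟨e, he, h⟩
      exact ⟨e, (hl e).2 he.1, he.2, h⟩
    · rintro ⟨e, he, h⟩
      exact ⟨e, ⟨(hl e).1 he, h.1⟩, h.2⟩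

end PathGame

/-! ### Stacks, numbers on stacks, and basic routines -/

/-- The alphabet of the stacks: bits, the separator of numbers, and an end mark. -/
inductive Letter : Type
  | bit (b : Bool) : Letter
  | sep : Letter
  | mark : Letter
  deriving DecidableEq

instance : Fintype Letter where
  elems := {.bit false, .bit true, .sep, .mark}
  complete s := by rcases s with (_ | _) | _ | _ <;> decide

/-- The stacks: the numbers `n`, `z`, `δ`, the budget `x`, and the list of arcs; the arcs that remain
to be scanned, the vertices on the path, the frames, and the delay bits of the frames; auxiliary
stacks `p`, `q`, `w`, `t`, and the operands `a`, `b`, `c`, `e` of comparisons. -/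
inductive Stk : Type
  | n | z | δ | x | arcs | cur | path | frames | delays | p | q | w | t | a | b | c | e
  deriving DecidableEq

instance : Fintype Stk where
  elems := {.n, .z, .δ, .x, .arcs, .cur, .path, .frames, .delays, .p, .q, .w, .t, .a, .b, .c, .e}
  complete k := by cases k <;> decide

/-- The contents of the stacks. -/
abbrev Store : Type := Stk → List Letter

/-- The programs on these stacks. -/
abbrev Prog : Type → Type 1 := Cmd Stk Letter

instance : Finite Ordering :=
  .of_injective (β := Option Bool)
    (fun o => match o with | .lt => none | .eq => some false | .gt => some true)
    (by rintro (_ | _ | _) (_ | _ | _) h <;> simp_all)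

namespace Letter

/-- Whether a letter is the separator. -/
def isSep (s : Letter) : Bool := s == .sep

/-- Whether a letter is the mark. -/
def isMark (s : Letter) : Bool := s == .mark

/-- The digit of a letter; everything but the bit `1` counts as `0`. -/
def digit : Option Letter → ℕ
  | some (.bit true) => 1
  | _ => 0

/-- The value of a word as a binary number, least significant bit first. -/
def value : List Letter → ℕ
  | [] => 0
  | s :: l => digit (some s) + 2 * value l

theorem value_eq_head_tail (l : List Letter) : value l = digit l.head? + 2 * value l.tail := by
  cases l <;> rfl

theorem digit_le_one : ∀ s : Option Letter, digit s ≤ 1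
  | none => by simp [digit]
  | some (.bit true) => by simp [digit]
  | some (.bit false) => by simp [digit]
  | some .sep => by simp [digit]
  | some .mark => by simp [digit]

/-- A number on a stack. -/
def field (m : ℕ) : List Letter := (Computability.encodeNat m).map .bit ++ [.sep]

/-- The separator counts as digit `0` in the highest place, so operands of comparisons may keep it.
-/
theorem value_map_bit_append (l : List Bool) : value (l.map .bit ++ [.sep]) = bitsValue l := by
  induction l with
  | nil => rfl
  | cons b l ih => cases b <;> simp [value, digit, bitsValue, ih]

theorem bitsValue_encodePosNum (p : PosNum) :
    bitsValue (Computability.encodePosNum p) = (p : ℕ) := by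
  induction p with
  | one => rfl
  | bit0 p ih => simp [Computability.encodePosNum, bitsValue, ih]; omega
  | bit1 p ih => simp [Computability.encodePosNum, bitsValue, ih]; omega

theorem bitsValue_encodeNat (m : ℕ) : bitsValue (Computability.encodeNat m) = m := by
  unfold Computability.encodeNat Computability.encodeNum
  conv_rhs => rw [← Num.to_of_nat m]
  cases (m : Num) with
  | zero => rfl
  | pos p => exact bitsValue_encodePosNum p

theorem value_field (m : ℕ) : value (field m) = m := by
  rw [field, value_map_bit_append, bitsValue_encodeNat]

end Letter

namespace Prog

open Cmd

/-- `Segment halts l r`: reading `l ++ r` up to the first letter that satisfies `halts` gives `l`,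
this letter included. -/
inductive Segment (halts : Letter → Bool) : List Letter → List Letter → Prop
  -- An empty segment is allowed only when the stack runs out; this case serves the draining of
  -- whole stacks.
  | nil : Segment halts [] []
  | last {s : Letter} {r : List Letter} (h : halts s = true) : Segment halts [s] r
  | cons {s : Letter} {l r : List Letter} (h : halts s = false) (hl : Segment halts l r) :
      Segment halts (s :: l) r

theorem segment_field (m : ℕ) (r : List Letter) : Segment Letter.isSep (Letter.field m) r := by
  unfold Letter.field
  induction Computability.encodeNat m with
  | nil => exact .last rfl
  | cons b l ih => exact .cons rfl ih

theorem segment_never (l : List Letter) : Segment (fun _ => false) l [] := by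
  induction l with
  | nil => exact .nil
  | cons s l ih => exact .cons rfl ih

/-- Pushes a letter on several stacks. -/
def pushAll (s : Letter) : List Stk → Prog Unit
  | [] => .pure ()
  | k :: ks => (Cmd.push k s).bind fun _ => pushAll s ks

/-- Pops letters from `k` until one satisfies `halts`, and pushes them on the stacks `ks`. -/
def drain (halts : Letter → Bool) (k : Stk) (ks : List Stk) : Prog Unit :=
  .iter (τ := Unit) (fun _ => (Cmd.pop k).bind fun s =>
    match s with
    | none => .pure (Sum.inr ())
    | some s => (pushAll s ks).bind fun _ =>
        .pure (if halts s then Sum.inr () else Sum.inl ())) ()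

theorem size_pushAll_le (s : Letter) (ks : List Stk) (S : Store) :
    size (fun k => if k ∈ ks then s :: S k else S k) ≤ size S + ks.length := by
  calc size (fun k => if k ∈ ks then s :: S k else S k)
      = ∑ k, ((S k).length + if k ∈ ks.toFinset then 1 else 0) := by
        refine Finset.sum_congr rfl fun k _ => ?_
        by_cases h : k ∈ ks <;> simp [h]
    _ = size S + ks.toFinset.card := by
        rw [Finset.sum_add_distrib, Finset.sum_ite_mem]
        simp [size]
    _ ≤ _ := by
        have := ks.toFinset_card_le
        omega

theorem runs_pushAll {B : ℕ} (s : Letter) (ks : List Stk) (S : Store) (hks : ks.Nodup)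
    (hB : size S + ks.length ≤ B) :
    Runs B (pushAll s ks) S () (fun k => if k ∈ ks then s :: S k else S k) := by
  induction ks generalizing S with
  | nil => exact Runs.cast (.pure (by simpa using hB)) rfl (by simp)
  | cons k ks ih =>
    rw [List.length_cons] at hB
    rw [List.nodup_cons] at hks
    have hs := size_update S k (s :: S k)
    rw [List.length_cons] at hs
    refine .bind (.push (by omega)) (Runs.cast (ih _ hks.2 (by omega)) rfl ?_)
    funext j
    by_cases hj : j = k
    · subst hj
      simp [hks.1]
    · simp [hj]

/-- The common source of all data movement: no target stack means deletion, one means a reversing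
move, and a second drain from `t` restores the order. Removed letters are not credited in the space
bound. -/
theorem runs_drain {B : ℕ} {halts : Letter → Bool} {k : Stk} {ks : List Stk} {l r : List Letter}
    (h : Segment halts l r) (S : Store) (hS : S k = l ++ r) (hk : k ∉ ks) (hks : ks.Nodup)
    (hB : size S + l.length * ks.length ≤ B) :
    Runs B (drain halts k ks) S ()
      (fun j => if j = k then r else if j ∈ ks then l.reverse ++ S j else S j) := by
  induction h generalizing S with
  | nil =>
    have hS : S k = [] := hS
    have e : (fun j => if j = k then [] else if j ∈ ks then ([] : List Letter).reverse ++ S j else S j)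
        = Function.update S k (S k).tail := by
      funext j
      by_cases hj : j = k
      · subst hj
        simp [hS]
      · simp [hj]
    rw [e]
    refine .exit (.bind (.pop (by omega)) ?_)
    rw [hS]
    refine .pure ?_
    rw [List.tail_nil, ← hS, Function.update_eq_self]
    omega
  | @last s r hs =>
    rw [List.length_singleton] at hB
    have hu := size_update S k (S k).tail
    rw [List.length_tail] at hu
    have hl : (S k).length = r.length + 1 := by simp [hS]
    have hp := runs_pushAll (B := B) s ks (Function.update S k (S k).tail) hks (by omega)
    refine .exit (.bind (.pop (by omega)) ?_)
    rw [show (S k).head? = some s by simp [hS]]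
    refine .bind hp ?_
    rw [if_pos hs]
    refine Runs.cast (.pure hp.size_le.2) rfl ?_
    funext j
    by_cases hj : j = k
    · subst hj
      simp [hS, hk]
    · simp [hj]
  | @cons s l r hs hl ih =>
    rw [List.length_cons, Nat.succ_mul] at hB
    have hu := size_update S k (S k).tail
    rw [List.length_tail] at hu
    have hl : (S k).length = l.length + r.length + 1 := by simp [hS]
    have hp := runs_pushAll (B := B) s ks (Function.update S k (S k).tail) hks (by omega)
    have hz := size_pushAll_le s ks (Function.update S k (S k).tail)
    refine .next (t' := ()) (S' := fun j => if j ∈ ks then s :: Function.update S k (S k).tail j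
      else Function.update S k (S k).tail j) (.bind (.pop (by omega)) ?_)
      (?_ : Runs B (drain halts k ks) _ _ _)
    · rw [show (S k).head? = some s by simp [hS]]
      refine .bind hp ?_
      rw [if_neg (by simp [hs])]
      exact .pure hp.size_le.2
    · refine Runs.cast (ih _ ?_ ?_) rfl ?_
      rotate_left 2
      · funext j
        by_cases hj : j = k
        · simp [hj]
        · by_cases hj' : j ∈ ks <;> simp [hj, hj']
      · simp [hS, hk]
      · omega

theorem runs_clear {B : ℕ} (k : Stk) (S : Store) (hB : size S ≤ B) :
    Runs B (drain (fun _ => false) k []) S () (Function.update S k []) := by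
  refine Runs.cast (runs_drain (segment_never (S k)) S (by simp) (by simp) (by simp) (by simpa))
    rfl ?_
  funext j
  by_cases hj : j = k <;> simp [hj]

theorem runs_drop {B : ℕ} {halts : Letter → Bool} {k : Stk} {l r : List Letter}
    (h : Segment halts l r) {S : Store} (hS : S k = l ++ r) (hB : size S ≤ B) :
    Runs B (drain halts k []) S () (Function.update S k r) := by
  refine Runs.cast (runs_drain h S hS (by simp) (by simp) (by simpa)) rfl ?_
  funext j
  by_cases hj : j = k <;> simp [hj]

theorem runs_move {B : ℕ} {halts : Letter → Bool} {k j : Stk} {l r : List Letter}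
    (h : Segment halts l r) {S : Store} (hS : S k = l ++ r) (hkj : k ≠ j)
    (hB : size S + l.length ≤ B) :
    Runs B (drain halts k [j]) S ()
      (Function.update (Function.update S k r) j (l.reverse ++ S j)) := by
  refine Runs.cast (runs_drain h S hS (by simpa) (by simp) (by simpa)) rfl ?_
  funext i
  by_cases hi : i = k
  · subst hi
    simp [hkj]
  · by_cases hj : i = j
    · subst hj
      simp [hi]
    · simp [hi, hj]

/-- Copies the first segment of the stack `k` to the stack `j`. -/
def copy (halts : Letter → Bool) (k j : Stk) : Prog Unit :=
  (drain halts k [.t]).bind fun _ => drain (fun _ => false) .t [k, j]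

theorem runs_copy {B : ℕ} {halts : Letter → Bool} {k j : Stk} {l r : List Letter}
    (h : Segment halts l r) {S : Store} (hS : S k = l ++ r) (hkj : k ≠ j) (hk : k ≠ .t)
    (hj : j ≠ .t) (ht : S .t = []) (hB : size S + 2 * l.length ≤ B) :
    Runs B (copy halts k j) S () (Function.update S j (l ++ S j)) := by
  have h₁ := size_update S k r
  have h₂ := size_update (Function.update S k r) .t l.reverse
  rw [Function.update_of_ne hk.symm, ht] at h₂
  simp only [hS, List.length_append, List.length_nil, List.length_reverse] at h₁ h₂
  refine .bind (runs_move h hS hk (by omega)) ?_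
  rw [ht, List.append_nil]
  refine Runs.cast (runs_drain (segment_never l.reverse) _ ?_ ?_ ?_ ?_) rfl ?_
  rotate_left 4
  · funext i
    by_cases hi : i = .t
    · subst hi
      simp [hj.symm, ht]
    · by_cases hik : i = k
      · subst hik
        simp [hk, hkj, hS]
      · by_cases hij : i = j
        · subst hij
          simp [hi, hik]
        · simp [hi, hik, hij]
  · simp
  · simp [hk.symm, hj.symm]
  · simp [hkj]
  · simp only [List.length_reverse, List.length_cons, List.length_nil]
    omega

/-- Moves the first segment of the stack `k` to the stack `j`. -/
def transfer (halts : Letter → Bool) (k j : Stk) : Prog Unit :=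
  (drain halts k [.t]).bind fun _ => drain (fun _ => false) .t [j]

theorem runs_transfer {B : ℕ} {halts : Letter → Bool} {k j : Stk} {l r : List Letter}
    (h : Segment halts l r) {S : Store} (hS : S k = l ++ r) (hkj : k ≠ j) (hk : k ≠ .t)
    (hj : j ≠ .t) (ht : S .t = []) (hB : size S + l.length ≤ B) :
    Runs B (transfer halts k j) S () (Function.update (Function.update S k r) j (l ++ S j)) := by
  have h₁ := size_update S k r
  have h₂ := size_update (Function.update S k r) .t l.reverse
  rw [Function.update_of_ne hk.symm, ht] at h₂
  simp only [hS, List.length_append, List.length_nil, List.length_reverse] at h₁ h₂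
  refine .bind (runs_move h hS hk (by omega)) ?_
  rw [ht, List.append_nil]
  refine Runs.cast (runs_move (segment_never l.reverse) (j := j) ?_ ?_ ?_) rfl ?_
  rotate_left 3
  · funext i
    by_cases hi : i = .t
    · subst hi
      simp [hj.symm, ht, hk.symm]
    · by_cases hik : i = k
      · subst hik
        simp [hk, hkj]
      · by_cases hij : i = j
        · subst hij
          simp [hi, hik]
        · simp [hi, hik, hij]
  · simp
  · exact hj.symm
  · simp only [List.length_reverse]
    omega

/-- Whether the stack `k` is empty. -/
def isEmpty (k : Stk) : Prog Bool :=
  (Cmd.pop k).bind fun s =>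
    match s with
    | none => .pure true
    | some s => (Cmd.push k s).bind fun _ => .pure false

theorem runs_isEmpty {B : ℕ} (k : Stk) (S : Store) (hB : size S ≤ B) :
    Runs B (isEmpty k) S (S k).isEmpty S := by
  have hu := size_update S k (S k).tail
  refine .bind (.pop hB) ?_
  cases hS : S k with
  | nil =>
    have : Function.update S k ([] : List Letter).tail = S := by
      rw [List.tail_nil, ← hS, Function.update_eq_self]
    rw [this]
    exact .pure hB
  | cons s l =>
    simp only [hS, List.tail_cons, List.length_cons] at hu
    have : Function.update (Function.update S k l) k (s :: Function.update S k l k) = S := by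
      rw [Function.update_self, Function.update_idem, ← hS, Function.update_eq_self]
    refine .bind (a := ()) (S' := S) ?_ (.pure hB)
    exact Runs.cast (.push (by rw [List.tail_cons]; omega)) rfl this

/-! ### Comparison of numbers -/

/-- One digit of the comparison of a sum of three numbers with a number. -/
def compareDigit (q : Fin 3 × Ordering) (x y u v : Option Letter) : Fin 3 × Ordering :=
  -- Three digits and a carry of at most `2` add up to at most `5`, so the new carry is again at
  -- most `2`.
  (⟨(q.1 + Letter.digit x + Letter.digit y + Letter.digit u) / 2, by
      have := Letter.digit_le_one x
      have := Letter.digit_le_one y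
      have := Letter.digit_le_one u
      omega⟩,
    (compare ((q.1 + Letter.digit x + Letter.digit y + Letter.digit u) % 2) (Letter.digit v)).then q.2)

/-- Compares the next digits. -/
def compareBody (q : Fin 3 × Ordering) : Prog ((Fin 3 × Ordering) ⊕ Ordering) :=
  (Cmd.pop .a).bind fun x => (Cmd.pop .b).bind fun y => (Cmd.pop .c).bind fun u =>
  (Cmd.pop .e).bind fun v => .pure <|
    if x.isNone && y.isNone && u.isNone && v.isNone then
      -- A carry beyond the last digit outweighs every verdict on lower digits.
      Sum.inr (if q.1 = 0 then q.2 else .gt)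
    else Sum.inl (compareDigit q x y u v)

/-- Compares the sum of the numbers on the stacks `a`, `b`, `c` with the number on the stack `e`, and
clears these stacks. -/
def compareSum : Prog Ordering :=
  .iter compareBody (0, .eq)

/-- The store with the operands of comparisons removed. -/
def clearOperands (S : Store) : Store
  | .a | .b | .c | .e => []
  | k => S k

theorem clearOperands_update (S : Store) {k : Stk} (h : k ∈ [Stk.a, .b, .c, .e])
    (l : List Letter) : clearOperands (Function.update S k l) = clearOperands S := by
  funext j
  by_cases hj : j = k
  · subst hj
    simp only [List.mem_cons, List.not_mem_nil, or_false] at h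
    rcases h with rfl | rfl | rfl | rfl <;> rfl
  · unfold clearOperands
    split <;> simp [hj]

/-- The higher digits, including the carry `s / 2`, decide; the lowest digit only breaks ties. This
is what makes comparison from the least significant bit possible. -/
theorem compare_digit_step (s d m n : ℕ) (hd : d ≤ 1) :
    compare (s + 2 * m) (d + 2 * n) = (compare (s / 2 + m) n).then (compare (s % 2) d) := by
  have hs := Nat.div_add_mod s 2
  have hs' := Nat.mod_lt s two_pos
  generalize s / 2 = x at *
  generalize s % 2 = y at *
  subst hs
  rcases lt_trichotomy (x + m) n with h | h | h
  · rw [compare_lt_iff_lt.2 h, compare_lt_iff_lt.2 (by omega)]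
    rfl
  · rw [compare_eq_iff_eq.2 h]
    rcases lt_trichotomy y d with h' | h' | h'
    · rw [compare_lt_iff_lt.2 h', compare_lt_iff_lt.2 (by omega)]
      rfl
    · rw [compare_eq_iff_eq.2 h', compare_eq_iff_eq.2 (by omega)]
      rfl
    · rw [compare_gt_iff_gt.2 h', compare_gt_iff_gt.2 (by omega)]
      rfl
  · rw [compare_gt_iff_gt.2 h, compare_gt_iff_gt.2 (by omega)]
    rfl

theorem size_tail_le (S : Store) (k : Stk) : size (Function.update S k (S k).tail) ≤ size S := by
  have := size_update S k (S k).tail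
  rw [List.length_tail] at this
  omega

theorem runs_compareBody {B : ℕ} (S : Store) (hB : size S ≤ B) (q : Fin 3 × Ordering) :
    Runs B (compareBody q) S
      (if (S .a).head?.isNone && (S .b).head?.isNone && (S .c).head?.isNone && (S .e).head?.isNone
        then Sum.inr (if q.1 = 0 then q.2 else .gt)
        else Sum.inl (compareDigit q (S .a).head? (S .b).head? (S .c).head? (S .e).head?))
      (Function.update (Function.update (Function.update (Function.update S .a (S .a).tail) .b
        (S .b).tail) .c (S .c).tail) .e (S .e).tail) := by
  have h₁ := size_tail_le S .a
  have h₂ := size_tail_le (Function.update S .a (S .a).tail) .b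
  have h₃ := size_tail_le (Function.update (Function.update S .a (S .a).tail) .b (S .b).tail) .c
  have h₄ := size_tail_le (Function.update (Function.update (Function.update S .a (S .a).tail) .b
    (S .b).tail) .c (S .c).tail) .e
  refine .bind (.pop hB) (.bind (.pop (by omega)) (.bind (.pop (h₂.trans (by omega)))
    (.bind (.pop (h₃.trans (h₂.trans (by omega)))) ?_)))
  exact .pure (h₄.trans (h₃.trans (h₂.trans (by omega))))

/-- The loop invariant: with carry `q.1` and verdict `q.2` on the digits already read, the unread
digits decide first. Induction on the total length of the operands. -/
theorem runs_compareSum_from {B m : ℕ} (q : Fin 3 × Ordering) (S : Store)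
    (hm : (S .a).length + (S .b).length + (S .c).length + (S .e).length ≤ m) (hB : size S ≤ B) :
    Runs B (.iter compareBody q) S
      ((compare (q.1 + Letter.value (S .a) + Letter.value (S .b) + Letter.value (S .c))
        (Letter.value (S .e))).then q.2) (clearOperands S) := by
  induction m generalizing q S with
  | zero =>
    have ha : S .a = [] := List.eq_nil_of_length_eq_zero (by omega)
    have hb : S .b = [] := List.eq_nil_of_length_eq_zero (by omega)
    have hc : S .c = [] := List.eq_nil_of_length_eq_zero (by omega)
    have he : S .e = [] := List.eq_nil_of_length_eq_zero (by omega)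
    refine .exit ?_
    refine Runs.cast (runs_compareBody S hB q) ?_ ?_
    · simp only [ha, hb, hc, he, List.head?_nil, Option.isNone_none, Bool.and_self, if_true,
        Letter.value, add_zero]
      congr 1
      obtain ⟨⟨c, hc⟩, o⟩ := q
      interval_cases c <;> rfl
    · funext k
      cases k <;> simp [clearOperands, ha, hb, hc, he]
  | succ m ih =>
    by_cases h0 : (S .a).length + (S .b).length + (S .c).length + (S .e).length = 0
    · exact ih q S (by omega) hB
    have hbody := Runs.cast (b := Sum.inl (compareDigit q (S .a).head? (S .b).head? (S .c).head?
      (S .e).head?)) (runs_compareBody S hB q) (if_neg ?_) rfl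
    · refine .next hbody ?_
      refine Runs.cast (ih _ _ ?_ hbody.size_le.2) ?_ ?_
      rotate_left
      · simp only [ne_eq, reduceCtorEq, not_false_eq_true, Function.update_of_ne,
          Function.update_self, compareDigit]
        rw [← Ordering.then_assoc, add_assoc, add_assoc, ← compare_digit_step _ _ _ _ (Letter.digit_le_one _),
          Letter.value_eq_head_tail (S .a), Letter.value_eq_head_tail (S .b),
          Letter.value_eq_head_tail (S .c), ← Letter.value_eq_head_tail (S .e)]
        congr 2
        ring
      · funext k
        cases k <;> simp [clearOperands]
      · simp
        omega
    · simp only [Bool.and_eq_true, Option.isNone_iff_eq_none, List.head?_eq_none_iff]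
      rintro ⟨⟨⟨ha, hb⟩, hc⟩, he⟩
      simp [ha, hb, hc, he] at h0

theorem runs_compareSum {B : ℕ} (S : Store) (hB : size S ≤ B) :
    Runs B compareSum S (compare (Letter.value (S .a) + Letter.value (S .b) + Letter.value (S .c))
      (Letter.value (S .e))) (clearOperands S) := by
  refine Runs.cast (runs_compareSum_from (B := B) (0, .eq) S le_rfl hB) ?_ rfl
  simp

/-- Compares the first numbers on the stacks `k` and `j`. -/
def compareFields (k j : Stk) : Prog Ordering :=
  (copy Letter.isSep k .a).bind fun _ => (copy Letter.isSep j .e).bind fun _ => compareSum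

/-- The operands of comparisons, and the auxiliary stack for copies, are empty. -/
def Idle (S : Store) : Prop := S .a = [] ∧ S .b = [] ∧ S .c = [] ∧ S .e = [] ∧ S .t = []

theorem Idle.clearOperands_eq {S : Store} (h : Idle S) : clearOperands S = S := by
  funext k
  unfold clearOperands
  split
  · exact h.1.symm
  · exact h.2.1.symm
  · exact h.2.2.1.symm
  · exact h.2.2.2.1.symm
  · rfl

theorem runs_compareFields {B : ℕ} {k j : Stk} {u v : ℕ} {r r' : List Letter} {S : Store}
    (hk : S k = Letter.field u ++ r) (hj : S j = Letter.field v ++ r') (hS : Idle S)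
    (hk' : k ∉ [Stk.a, .e, .t]) (hj' : j ∉ [Stk.a, .e, .t])
    (hB : size S + 2 * (Letter.field u).length + 2 * (Letter.field v).length ≤ B) :
    Runs B (compareFields k j) S (compare u v) S := by
  have hclear := hS.clearOperands_eq
  obtain ⟨ha, hb, hc, he, ht⟩ := hS
  simp only [List.mem_cons, List.not_mem_nil, or_false, not_or] at hk' hj'
  have h₁ := size_update S .a (Letter.field u)
  have h₂ := size_update (Function.update S .a (Letter.field u)) .e (Letter.field v)
  refine .bind (runs_copy (segment_field u r) hk hk'.1 hk'.2.2 (by simp) ht (by omega)) ?_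
  rw [ha, List.append_nil]
  refine .bind (runs_copy (segment_field v r') (by rw [Function.update_of_ne hj'.1, hj]) hj'.2.1
    hj'.2.2 (by simp) (by simpa) (by omega)) ?_
  rw [Function.update_of_ne (by simp), he, List.append_nil]
  refine Runs.cast (runs_compareSum _ ?_) ?_ ?_
  rotate_left
  · simp [Letter.value_field, hb, hc, Letter.value]
  · rw [clearOperands_update _ (by simp), clearOperands_update _ (by simp), hclear]
  · omega

/-! ### Counters -/

/-- Passes the carry `c` through the next digit on the stack `x`. -/
def bumpBody (b c : Bool) : Prog (Bool ⊕ Bool) :=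
  (Cmd.pop .x).bind fun s =>
    match s with
    | some (.bit y) => (Cmd.push .t (.bit (y ^^ c))).bind fun _ => .pure (Sum.inl (c && (y == b)))
    | some s => (Cmd.push .x s).bind fun _ => .pure (Sum.inr c)
    | none => .pure (Sum.inr c)

/-- Increments (`b = true`) or decrements (`b = false`) the number on the stack `x`, and returns the
carry that is left. -/
def bumpCounter (b : Bool) : Prog Bool :=
  (Cmd.iter (bumpBody b) true).bind fun c =>
  (drain (fun _ => false) .t [.x]).bind fun _ => .pure c

theorem runs_bumpCounter_loop {B : ℕ} (b c : Bool) (l : List Bool) (S : Store)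
    (hx : S .x = l.map .bit ++ [.sep]) (hB : size S ≤ B) :
    Runs B (.iter (bumpBody b) c) S (bump b c l).2
      (Function.update (Function.update S .x [.sep]) .t
        (((bump b c l).1.map .bit).reverse ++ S .t)) := by
  induction l generalizing c S with
  | nil =>
    have hu := size_update S .x (S .x).tail
    rw [hx] at hu
    simp only [List.map_nil, List.nil_append, List.length_singleton, List.tail_cons,
      List.length_nil] at hu
    refine .exit (.bind (.pop hB) ?_)
    rw [hx]
    refine .bind (.push (by simp only [List.map_nil, List.nil_append, List.tail_cons]; omega)) ?_
    refine Runs.cast (.pure ?_) rfl ?_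
    · simp only [Function.update_self, Function.update_idem]
      have := size_update S .x [.sep]
      simp [hx] at this ⊢
      omega
    · funext k
      cases k <;> simp [bump]
  | cons y l ih =>
    have hu := size_update S .x (S .x).tail
    have hl : (S .x).length = l.length + 2 := by simp [hx]
    rw [List.length_tail] at hu
    have hv := size_update (Function.update S .x (S .x).tail) .t
      (.bit (y ^^ c) :: Function.update S .x (S .x).tail .t)
    rw [List.length_cons] at hv
    refine .next (t' := c && (y == b)) (S' := Function.update (Function.update S .x (S .x).tail) .t
        (.bit (y ^^ c) :: Function.update S .x (S .x).tail .t)) (.bind (.pop hB) ?_) ?_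
    · rw [show (S .x).head? = some (.bit y) by rw [hx]; rfl]
      exact .bind (.push (by omega)) (.pure (by omega))
    · refine Runs.cast (ih _ _ ?_ ?_) (by simp [bump]) ?_
      rotate_left 2
      · funext k
        cases k <;> simp [bump]
      · simp [hx]
      · omega

theorem runs_bumpCounter {B : ℕ} (b : Bool) (l : List Bool) (S : Store)
    (hx : S .x = l.map .bit ++ [.sep]) (ht : S .t = []) (hB : size S + l.length ≤ B) :
    Runs B (bumpCounter b) S (bump b true l).2
      (Function.update S .x ((bump b true l).1.map .bit ++ [.sep])) := by
  have h₁ := size_update S .x [.sep]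
  have h₂ := size_update (Function.update S .x [.sep]) .t (((bump b true l).1.map .bit).reverse)
  simp only [hx, ht, List.length_append, List.length_map, List.length_singleton,
    List.length_reverse, List.length_nil, length_bump, ne_eq, reduceCtorEq, not_false_eq_true,
    Function.update_of_ne] at h₁ h₂
  refine .bind (runs_bumpCounter_loop b true l S hx (by omega)) ?_
  rw [ht, List.append_nil]
  have hm := runs_move (B := B) (k := .t) (j := .x)
    (S := Function.update (Function.update S .x [.sep]) .t ((bump b true l).1.map .bit).reverse)
    (segment_never ((bump b true l).1.map .bit).reverse) (by simp) (by simp)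
    (by simp only [List.length_reverse, List.length_map, length_bump]; omega)
  refine Runs.cast (.bind hm (.pure hm.size_le.2)) rfl ?_
  funext k
  cases k <;> simp [ht]

end Prog

/-! ### Checking a move -/

namespace Prog

open Cmd Letter

theorem size_update_le {B : ℕ} {S : Store} {k : Stk} {l : List Letter}
    (h : size S + l.length ≤ B) : size (Function.update S k l) ≤ B := by
  have := size_update S k l
  omega

/-- Peels one update from a nested store, charging the new contents and ignoring what they
overwrite. Iterating it reduces space goals to arithmetic on lengths. -/
theorem size_update_add_le {B c : ℕ} {S : Store} {k : Stk} {l : List Letter}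
    (h : size S + (l.length + c) ≤ B) : size (Function.update S k l) + c ≤ B := by
  have := size_update S k l
  omega

/-- If the last move was delayed, puts the length of a delay on the stack `c`. -/
def delayOperand : Prog Unit :=
  (Cmd.pop .delays).bind fun d =>
    match d with
    | none => .pure ()
    | some s => (Cmd.push .delays s).bind fun _ =>
        if s = .bit true then copy isSep .δ .c else .pure ()

theorem runs_delayOperand {B d : ℕ} {S : Store} (hδ : S .δ = field d) (hc : S .c = [])
    (ht : S .t = []) (hB : size S + 2 * (field d).length ≤ B) :
    Runs B delayOperand S ()
      (if (S .delays).head? = some (.bit true) then Function.update S .c (field d) else S) := by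
  have hu := size_update S .delays (S .delays).tail
  refine .bind (.pop (by omega)) ?_
  cases hS : S .delays with
  | nil =>
    have : Function.update S .delays ([] : List Letter).tail = S := by
      rw [List.tail_nil, ← hS, Function.update_eq_self]
    rw [this]
    exact .pure (by omega)
  | cons s l =>
    simp only [hS, List.tail_cons, List.length_cons] at hu
    have : Function.update (Function.update S .delays l) .delays
        (s :: Function.update S .delays l .delays) = S := by
      rw [Function.update_self, Function.update_idem, ← hS, Function.update_eq_self]
    refine .bind (a := ()) (S' := S) ?_ ?_
    · exact Runs.cast (.push (by rw [List.tail_cons]; omega)) rfl this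
    · by_cases hs : s = .bit true
      · subst hs
        simp only [if_true, List.head?_cons]
        refine Runs.cast (runs_copy (segment_field d []) (by simpa using hδ) (by simp) (by simp)
          (by simp) ht hB) rfl ?_
        rw [hc, List.append_nil]
      · simp only [hs, if_false, List.head?_cons, Option.some.injEq]
        exact .pure (by omega)

/-- Copies the third and the fourth number on the stack `frames` to the stacks `a` and `b`. -/
def timeOperands : Prog Unit :=
  (drain isSep .frames [.q]).bind fun _ =>
  (drain isSep .frames [.q]).bind fun _ =>
  (copy isSep .frames .a).bind fun _ =>
  (drain isSep .frames [.q]).bind fun _ =>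
  (copy isSep .frames .b).bind fun _ =>
  drain (fun _ => false) .q [.frames]

theorem runs_timeOperands {B M f₁ f₂ f₃ f₄ : ℕ} {r : List Letter} {S : Store}
    (hfr : S .frames = field f₁ ++ (field f₂ ++ (field f₃ ++ (field f₄ ++ r))))
    (ha : S .a = []) (hb : S .b = []) (ht : S .t = []) (hq : S .q = [])
    (hM : (S .frames).length ≤ M) (hB : size S + 10 * M ≤ B) :
    Runs B timeOperands S ()
      (Function.update (Function.update S .a (field f₃)) .b (field f₄)) := by
  rw [hfr] at hM
  simp only [List.length_append] at hM
  refine .bind (S' := Function.update (Function.update S .frames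
      (field f₂ ++ (field f₃ ++ (field f₄ ++ r)))) .q (field f₁).reverse)
    (Runs.cast (runs_move (segment_field f₁ _) hfr (by simp) (by omega)) rfl (by simp [hq])) ?_
  refine .bind (S' := Function.update (Function.update S .frames
      (field f₃ ++ (field f₄ ++ r))) .q ((field f₂).reverse ++ (field f₁).reverse))
    (Runs.cast (runs_move (segment_field f₂ _) (by simp; rfl) (by simp) ?_) rfl ?_) ?_
  · iterate 2 refine size_update_add_le ?_
    simp only [List.length_append, List.length_reverse]
    omega
  · funext k
    cases k <;> simp
  refine .bind (S' := Function.update (Function.update (Function.update S .frames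
      (field f₃ ++ (field f₄ ++ r))) .q ((field f₂).reverse ++ (field f₁).reverse)) .a (field f₃))
    (Runs.cast (runs_copy (segment_field f₃ _) (by simp; rfl) (by simp) (by simp) (by simp)
      (by simp [ht]) ?_) rfl (by simp [ha])) ?_
  · iterate 2 refine size_update_add_le ?_
    simp only [List.length_append, List.length_reverse]
    omega
  refine .bind (S' := Function.update (Function.update (Function.update S .frames (field f₄ ++ r)) .q
      ((field f₃).reverse ++ ((field f₂).reverse ++ (field f₁).reverse))) .a (field f₃))
    (Runs.cast (runs_move (segment_field f₃ _) (by simp; rfl) (by simp) ?_) rfl ?_) ?_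
  · iterate 3 refine size_update_add_le ?_
    simp only [List.length_append, List.length_reverse]
    omega
  · funext k
    cases k <;> simp
  refine .bind (S' := Function.update (Function.update (Function.update
      (Function.update S .frames (field f₄ ++ r)) .q
      ((field f₃).reverse ++ ((field f₂).reverse ++ (field f₁).reverse))) .a (field f₃)) .b
      (field f₄))
    (Runs.cast (runs_copy (segment_field f₄ _) (by simp; rfl) (by simp) (by simp) (by simp)
      (by simp [ht]) ?_) rfl (by simp [hb])) ?_
  · iterate 3 refine size_update_add_le ?_
    simp only [List.length_append, List.length_reverse]
    omega
  refine Runs.cast (runs_move (segment_never _) (by simp; rfl) (by simp) ?_) rfl ?_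
  · iterate 4 refine size_update_add_le ?_
    simp only [List.length_append, List.length_reverse]
    omega
  · funext k
    cases k <;> simp [hq, hfr]

/-- Compares the time at which the traveler is ready with the number on the stack `cur`. -/
def checkTime : Prog Ordering :=
  (copy isSep .cur .e).bind fun _ => timeOperands.bind fun _ =>
  delayOperand.bind fun _ => compareSum

/-- The current time is never stored: it is the sum of label and traversal time of the arc on top of
`frames`, and of `d` if the top delay bit is set. The sum is formed only digit by digit during the
comparison. -/
theorem runs_checkTime {B M t f₁ f₂ f₃ f₄ d : ℕ} {r r' : List Letter} {S : Store}
    (hcur : S .cur = field t ++ r)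
    (hfr : S .frames = field f₁ ++ (field f₂ ++ (field f₃ ++ (field f₄ ++ r'))))
    (hδ : S .δ = field d) (hS : Idle S) (hq : S .q = []) (hM : ∀ k, (S k).length ≤ M)
    (hB : size S + 15 * M ≤ B) :
    Runs B checkTime S
      (compare (f₃ + f₄ + if (S .delays).head? = some (.bit true) then d else 0) t) S := by
  have hclear := hS.clearOperands_eq
  obtain ⟨ha, hb, hc, he, ht⟩ := hS
  have h₁ := hM .cur
  have h₂ := hM .frames
  have h₃ := hM .δ
  rw [hcur, List.length_append] at h₁
  rw [hδ] at h₃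
  refine .bind (S' := Function.update S .e (field t)) (Runs.cast (runs_copy (segment_field t r) hcur
    (by simp) (by simp) (by simp) ht (by omega)) rfl (by simp [he])) ?_
  refine .bind (runs_timeOperands (M := M) (f₁ := f₁) (f₂ := f₂) (r := r')
    (by simpa using hfr) (by simp [ha]) (by simp [hb])
    (by simp [ht]) (by simp [hq]) (by simp [h₂]) (size_update_add_le (by omega))) ?_
  rw [hfr] at h₂
  simp only [List.length_append] at h₂
  refine .bind (runs_delayOperand (d := d) (by simp [hδ]) (by simp [hc]) (by simp [ht]) ?_) ?_
  · iterate 3 refine size_update_add_le ?_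
    omega
  refine Runs.cast (runs_compareSum _ ?_) ?_ ?_
  · split_ifs
    · refine size_update_le ?_
      iterate 3 refine size_update_add_le ?_
      omega
    · refine size_update_le ?_
      iterate 2 refine size_update_add_le ?_
      omega
  · simp only [ne_eq, reduceCtorEq, not_false_eq_true, Function.update_of_ne]
    split_ifs <;> simp [value_field, hc, value]
  · split_ifs <;> simp [clearOperands_update, hclear]

/-- Whether the number on the stack `w` is on the stack `path`. -/
def checkVisited : Prog Bool :=
  (Cmd.iter (τ := Bool) (fun found => (isEmpty .path).bind fun b =>
    if b then .pure (Sum.inr found)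
    else (compareFields .path .w).bind fun o => (drain isSep .path [.q]).bind fun _ =>
      .pure (Sum.inl (found || o == .eq))) false).bind fun found =>
  (drain (fun _ => false) .q [.path]).bind fun _ => .pure found

theorem field_ne_nil (m : ℕ) : field m ≠ [] := by
  simp [field]

/-- The loop does not stop at a hit; the whole path always ends up reversed on `q`, so one drain
restores it. -/
theorem runs_checkVisited_loop {B M v : ℕ} (found : Bool) (fs : List ℕ) {r : List Letter}
    {S : Store} (hpath : S .path = fs.flatMap field) (hw : S .w = field v ++ r) (hS : Idle S)
    (hMp : (S .path).length ≤ M) (hMw : (S .w).length ≤ M) (hB : size S + 5 * M ≤ B) :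
    Runs B (Cmd.iter (τ := Bool) (fun found => (isEmpty .path).bind fun b =>
      if b then .pure (Sum.inr found)
      else (compareFields .path .w).bind fun o => (drain isSep .path [.q]).bind fun _ =>
        .pure (Sum.inl (found || o == .eq))) found) S (found || decide (v ∈ fs))
      (Function.update (Function.update S .path []) .q ((S .path).reverse ++ S .q)) := by
  induction fs generalizing found S with
  | nil =>
    refine .exit (.bind (runs_isEmpty _ _ (by omega)) ?_)
    simp only [List.flatMap_nil] at hpath
    simp only [hpath, List.isEmpty_nil, if_true, List.not_mem_nil, decide_false, Bool.or_false,
      List.reverse_nil, List.nil_append]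
    refine Runs.cast (.pure (by omega)) rfl ?_
    rw [← hpath, Function.update_eq_self, Function.update_eq_self]
  | cons f fs ih =>
    rw [List.flatMap_cons] at hpath
    have hlp := hMp
    have hlw := hMw
    rw [hpath, List.length_append] at hlp
    rw [hw, List.length_append] at hlw
    have hmove := runs_move (B := B) (j := .q) (segment_field f _) hpath (by simp) (by omega)
    have hsize := size_update S .path (fs.flatMap field)
    have hsize' := size_update (Function.update S .path (fs.flatMap field)) .q
      ((field f).reverse ++ S .q)
    simp only [hpath, List.length_append, List.length_reverse, ne_eq, reduceCtorEq,
      not_false_eq_true, Function.update_of_ne] at hsize hsize'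
    refine .next (t' := found || compare f v == .eq) (.bind (runs_isEmpty _ _ (by omega)) ?_)
      (Runs.cast (ih _ (S := Function.update (Function.update S .path (fs.flatMap field)) .q
        ((field f).reverse ++ S .q)) (by simp) (by simpa using hw) ?_ ?_ (by simpa using hMw)
        (by omega)) ?_ ?_)
    · rw [List.isEmpty_eq_false_iff.2 (by simp [hpath, field_ne_nil])]
      refine .bind (runs_compareFields hpath hw hS (by simp) (by simp) (by omega)) ?_
      exact .bind hmove (.pure hmove.size_le.2)
    · simpa [Idle] using hS
    · simp only [ne_eq, reduceCtorEq, not_false_eq_true, Function.update_of_ne,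
        Function.update_self]
      omega
    · have : (compare f v == .eq) = decide (v = f) := by
        rw [Bool.eq_iff_iff, beq_iff_eq, compare_eq_iff_eq, decide_eq_true_iff, eq_comm]
      rw [this, Bool.or_assoc]
      simp
    · funext k
      cases k <;> simp [hpath]

theorem runs_checkVisited {B M v : ℕ} {fs : List ℕ} {r : List Letter}
    {S : Store} (hpath : S .path = fs.flatMap field) (hw : S .w = field v ++ r) (hS : Idle S)
    (hq : S .q = []) (hMp : (S .path).length ≤ M) (hMw : (S .w).length ≤ M)
    (hB : size S + 5 * M ≤ B) :
    Runs B checkVisited S (decide (v ∈ fs)) S := by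
  have h := runs_checkVisited_loop false fs hpath hw hS hMp hMw hB
  have hsize := size_update S .path []
  have hsize' := size_update (Function.update S .path []) .q (S .path).reverse
  simp only [List.length_nil, List.length_reverse, hq, ne_eq, reduceCtorEq,
    not_false_eq_true, Function.update_of_ne] at hsize hsize'
  rw [hq, List.append_nil] at h
  refine .bind h (.bind (Runs.cast (runs_move (segment_never _) (by simp; rfl) (by simp) ?_)
    rfl ?_) (.pure (by omega)))
  · rw [List.length_reverse]
    omega
  · funext k
    cases k <;> simp [hq]

/-- Whether the traveler may take the arc on the stack `cur`; leaves its end vertex on `w`. -/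
def checkArc : Prog Bool :=
  (compareFields .cur .path).bind fun o₁ =>
  (drain isSep .cur [.p]).bind fun _ =>
  (copy isSep .cur .w).bind fun _ =>
  (drain isSep .cur [.p]).bind fun _ =>
  checkTime.bind fun o₂ =>
  (drain (fun _ => false) .p [.cur]).bind fun _ =>
  checkVisited.bind fun b => .pure (o₁ == .eq && o₂ != .gt && !b)

set_option maxHeartbeats 1000000 in
theorem runs_checkArc {B M v w t u f₁ f₂ f₃ f₄ d c : ℕ} {fs : List ℕ} {r r' : List Letter}
    {S : Store} (hcur : S .cur = field v ++ (field w ++ (field t ++ (field u ++ r))))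
    (hfr : S .frames = field f₁ ++ (field f₂ ++ (field f₃ ++ (field f₄ ++ r'))))
    (hpath : S .path = (c :: fs).flatMap field)
    (hδ : S .δ = field d) (hS : Idle S) (hp : S .p = []) (hq : S .q = []) (hw : S .w = [])
    (hM : ∀ k, (S k).length ≤ M) (hB : size S + 20 * M ≤ B) :
    Runs B checkArc S
      (decide (v = c ∧
        (f₃ + f₄ + if (S .delays).head? = some (.bit true) then d else 0) ≤ t ∧ w ∉ c :: fs))
      (Function.update S .w (field w)) := by
  have h₁ := hM .cur
  have h₂ := hM .path
  rw [hcur] at h₁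
  rw [hpath] at h₂
  simp only [List.length_append, List.flatMap_cons] at h₁ h₂
  refine .bind (runs_compareFields hcur (by simpa using hpath) hS (by simp) (by simp) (by omega)) ?_
  refine .bind (S' := Function.update (Function.update S .cur (field w ++ (field t ++ (field u ++ r))))
    .p (field v).reverse) (Runs.cast (runs_move (segment_field v _) hcur (by simp) (by omega)) rfl
      (by simp [hp])) ?_
  refine .bind (S' := Function.update (Function.update (Function.update S .cur
    (field w ++ (field t ++ (field u ++ r)))) .p (field v).reverse) .w (field w))
    (Runs.cast (runs_copy (segment_field w _) (by simp; rfl) (by simp) (by simp) (by simp)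
      (by simp [hS.2.2.2.2]) ?_) rfl (by simp [hw])) ?_
  · iterate 2 refine size_update_add_le ?_
    simp only [List.length_append, List.length_reverse]
    omega
  refine .bind (S' := Function.update (Function.update (Function.update S .cur
    (field t ++ (field u ++ r))) .p ((field w).reverse ++ (field v).reverse)) .w (field w))
    (Runs.cast (runs_move (segment_field w _) (by simp; rfl) (by simp) ?_) rfl ?_) ?_
  · iterate 3 refine size_update_add_le ?_
    simp only [List.length_append, List.length_reverse]
    omega
  · funext k
    cases k <;> simp
  refine .bind (runs_checkTime (M := M) (t := t) (r := field u ++ r) (by simp) (by simpa using hfr)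
    (by simpa using hδ) (by simpa [Idle] using hS) (by simpa using hq) ?_ ?_) ?_
  · intro k
    have := hM k
    cases k <;> simp <;> first | assumption | omega
  · iterate 3 refine size_update_add_le ?_
    simp only [List.length_append, List.length_reverse]
    omega
  refine .bind (S' := Function.update S .w (field w))
    (Runs.cast (runs_move (segment_never _) (by simp; rfl) (by simp) ?_) rfl ?_) ?_
  · iterate 3 refine size_update_add_le ?_
    simp only [List.length_append, List.length_reverse]
    omega
  · funext k
    cases k <;> simp [hp, hcur]
  refine .bind (runs_checkVisited (M := M) (v := w) (r := []) (fs := c :: fs) (by simpa using hpath)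
    (by simp) (by simpa [Idle] using hS) (by simpa using hq) (by simpa using hM .path)
    (by simp; omega) (size_update_add_le (by omega))) ?_
  refine Runs.cast (.pure (size_update_le (by omega))) ?_ rfl
  rw [Bool.eq_iff_iff]
  simp only [Bool.and_eq_true, beq_iff_eq, bne_iff_ne, ne_eq, compare_eq_iff_eq,
    compare_gt_iff_gt, not_lt, Bool.not_eq_true', decide_eq_false_iff_not, decide_eq_true_eq,
    and_assoc, Function.update_of_ne, reduceCtorEq, not_false_eq_true]

end Prog

/-! ### The search as a program -/

namespace Prog

open Cmd Letter PathGame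

instance : Finite Mode :=
  .of_injective (β := Option (Option Bool))
    (fun m => match m with | .down => none | .scan => some none | .ret b => some (some b))
    (by rintro (_ | _ | _) (_ | _ | _) h <;> simp_all)

/-- Removes the first arc from the stack `cur`. -/
def dropArc : Prog Unit :=
  (drain isSep .cur []).bind fun _ => (drain isSep .cur []).bind fun _ =>
  (drain isSep .cur []).bind fun _ => drain isSep .cur []

/-- The search looks at a new position. -/
def downBody : Prog (Mode ⊕ Bool) :=
  (compareFields .path .z).bind fun o =>
    if o = .eq then .pure (Sum.inl (.ret true))
    else (copy (fun _ => false) .arcs .cur).bind fun _ => .pure (Sum.inl .scan)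

/-- Pushes the frame of the first arc on the stack `cur`, whose end vertex is on the stack `w`. -/
def pushFrame : Prog Unit :=
  (transfer (fun _ => false) .w .path).bind fun _ =>
  (Cmd.push .delays (.bit false)).bind fun _ =>
  (Cmd.push .frames .mark).bind fun _ => transfer (fun _ => false) .cur .frames

/-- The search tries the next arc. -/
def scanBody : Prog (Mode ⊕ Bool) :=
  (isEmpty .cur).bind fun b =>
    if b then .pure (Sum.inl (.ret false))
    else checkArc.bind fun b =>
      if b then pushFrame.bind fun _ => .pure (Sum.inl .down)
      else (drain (fun _ => false) .w []).bind fun _ => dropArc.bind fun _ => .pure (Sum.inl .scan)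

/-- The search leaves a position, whose frame is removed except for the delay bit, with the
answer `b`. -/
def leave (b : Bool) : Prog (Mode ⊕ Bool) :=
  (drain isSep .path []).bind fun _ =>
  (drain isMark .frames [.t]).bind fun _ =>
  (Cmd.pop .t).bind fun _ =>
  (drain (fun _ => false) .t [.cur]).bind fun _ =>
  dropArc.bind fun _ =>
    if b then (drain (fun _ => false) .cur []).bind fun _ => .pure (Sum.inl (.ret true))
    else .pure (Sum.inl .scan)

/-- The search returns from a position with the answer `b`. -/
def retBody (b : Bool) : Prog (Mode ⊕ Bool) :=
  (Cmd.pop .delays).bind fun s =>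
    match s with
    | none => .pure (Sum.inr b)
    | some s =>
      if s = .bit true then (bumpCounter true).bind fun _ => leave b
      else if b then (bumpCounter false).bind fun c =>
        if c then (bumpCounter true).bind fun _ => leave true
        else (Cmd.push .delays (.bit true)).bind fun _ => .pure (Sum.inl .down)
      else leave false

/-- One step of the search. -/
def searchBody : Mode → Prog (Mode ⊕ Bool)
  | .down => downBody
  | .scan => scanBody
  | .ret b => retBody b

/-- The search. -/
def search : Prog Bool := .iter searchBody .down

/-! ### Search states on stacks and the simulation of single steps -/

/-- An arc on a stack. -/
def arcLetters {n : ℕ} (e : TimeArc n) : List Letter :=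
  field e.src ++ (field e.dst ++ (field e.time ++ field e.trav))

/-- The arcs and the end mark of a frame on a stack. -/
def frameLetters {n : ℕ} (f : Frame n) : List Letter :=
  arcLetters f.2.1 ++ f.2.2.flatMap arcLetters ++ [.mark]

/-- The stacks in a state of the search. -/
def store (G : PathGame) (l : List (TimeArc G.n)) (s : Search G.n) : Store
  | .n => field G.n
  | .z => field G.z
  | .δ => field G.δ
  | .x => s.budget.map .bit ++ [.sep]
  | .arcs => l.flatMap arcLetters
  | .cur => s.cur.flatMap arcLetters
  | .path => s.frames.flatMap (fun f => field f.2.1.dst) ++ field G.s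
  | .frames => s.frames.flatMap frameLetters ++ (field 0 ++ (field 0 ++ (field 0 ++ field 0)))
  | .delays => s.frames.map fun f => .bit f.1
  | _ => []

variable {G : PathGame} {l : List (TimeArc G.n)}

theorem idle_store (s : Search G.n) : Idle (store G l s) := ⟨rfl, rfl, rfl, rfl, rfl⟩

theorem exists_store_path (m : Mode) (c : List (TimeArc G.n)) (fr : List (Frame G.n))
    (β : List Bool) : ∃ fs : List ℕ,
      store G l ⟨m, c, fr, β⟩ .path =
        (((framesPosition G fr).vertex : ℕ) :: fs).flatMap field ∧
      ∀ v : Fin G.n, (v : ℕ) ∈ ((framesPosition G fr).vertex : ℕ) :: fs ↔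
        v ∈ (framesPosition G fr).visited := by
  have key : ∃ fs : List ℕ, (((framesPosition G fr).vertex : ℕ) :: fs) =
      (fr.map fun f => (f.2.1.dst : ℕ)) ++ [(G.s : ℕ)] := by
    cases fr with
    | nil => exact ⟨[], rfl⟩
    | cons f fr => exact ⟨(fr.map fun f => (f.2.1.dst : ℕ)) ++ [(G.s : ℕ)], rfl⟩
  obtain ⟨fs, hfs⟩ := key
  refine ⟨fs, ?_, ?_⟩
  · rw [hfs]
    simp [store, List.flatMap_append, List.flatMap_map]
  · intro v
    rw [hfs, visited_framesPosition]
    simp only [List.mem_append, List.mem_map, List.mem_singleton, Fin.val_inj]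
    exact or_comm

/-- The four zeros below the frames act as a fictitious undelayed arc that arrives at time `0`, so
the time check needs no special case at the start. -/
theorem exists_store_frames (m : Mode) (c : List (TimeArc G.n)) (fr : List (Frame G.n))
    (β : List Bool) : ∃ f₁ f₂ f₃ f₄ r,
      store G l ⟨m, c, fr, β⟩ .frames = field f₁ ++ (field f₂ ++ (field f₃ ++ (field f₄ ++ r))) ∧
      (f₃ + f₄ + if (store G l ⟨m, c, fr, β⟩ .delays).head? = some (.bit true) then G.δ else 0) =
        (framesPosition G fr).time := by
  cases fr with
  | nil =>
    exact ⟨0, 0, 0, 0, [], by simp [store], by simp [store, framesPosition, start]⟩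
  | cons f fr =>
    obtain ⟨d, e, rest⟩ := f
    refine ⟨e.src, e.dst, e.time, e.trav, rest.flatMap arcLetters ++ (.mark ::
      (fr.flatMap frameLetters ++ (field 0 ++ (field 0 ++ (field 0 ++ field 0))))), ?_, ?_⟩
    · simp [store, frameLetters, arcLetters]
    · cases d <;> simp [store, framesPosition, next]

theorem runs_dropArc {B : ℕ} {e : TimeArc G.n} {r : List Letter} {S : Store}
    (hcur : S .cur = arcLetters e ++ r) (hB : size S ≤ B) :
    Runs B dropArc S () (Function.update S .cur r) := by
  simp only [arcLetters, List.append_assoc] at hcur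
  have hl := congrArg List.length hcur
  simp only [List.length_append] at hl
  have h (l' : List Letter) (hl' : l'.length ≤ (S .cur).length) :
      size (Function.update S .cur l') ≤ B := by
    have := size_update S .cur l'
    omega
  refine .bind (runs_drop (segment_field _ _) hcur hB) ?_
  refine .bind (Runs.cast (runs_drop (segment_field _ _) (Function.update_self ..)
    (h _ (by simp only [List.length_append]; omega))) rfl (Function.update_idem ..)) ?_
  refine .bind (Runs.cast (runs_drop (segment_field _ _) (Function.update_self ..)
    (h _ (by simp only [List.length_append]; omega))) rfl (Function.update_idem ..)) ?_
  exact Runs.cast (runs_drop (segment_field _ _) (Function.update_self ..)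
    (h _ (by simp only [List.length_append]; omega))) rfl (Function.update_idem ..)

theorem runs_downBody {B M : ℕ} {c : List (TimeArc G.n)} {fr : List (Frame G.n)} {β : List Bool}
    (hc : c = []) (hM : ∀ k, (store G l ⟨.down, c, fr, β⟩ k).length ≤ M)
    (hB : size (store G l ⟨.down, c, fr, β⟩) + 5 * M ≤ B) :
    Runs B downBody (store G l ⟨.down, c, fr, β⟩) (Sum.inl (searchStep l ⟨.down, c, fr, β⟩).mode)
      (store G l (searchStep l ⟨.down, c, fr, β⟩)) := by
  subst hc
  obtain ⟨fs, hfs, -⟩ := exists_store_path (l := l) .down [] fr β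
  have h₁ := hM .path
  have h₂ := hM .z
  have h₃ := hM .arcs
  rw [hfs, List.flatMap_cons, List.length_append] at h₁
  refine .bind (runs_compareFields (u := (framesPosition G fr).vertex) (v := G.z) (r' := [])
    (by simpa using hfs) (by simp [store]) (idle_store _) (by simp) (by simp) ?_) ?_
  · simp only [store] at h₂
    omega
  by_cases hz : (framesPosition G fr).vertex = G.z
  · rw [hz, compare_eq_iff_eq.2 rfl, if_pos rfl]
    simp only [searchStep, hz, if_true]
    exact .pure (by omega)
  · rw [if_neg (by rwa [compare_eq_iff_eq, Fin.val_inj])]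
    simp only [searchStep, hz, if_false]
    have hcopy : Runs B (copy (fun _ => false) .arcs .cur) (store G l ⟨.down, [], fr, β⟩) ()
        (store G l ⟨.scan, l, fr, β⟩) := by
      refine Runs.cast (runs_copy (segment_never _) (List.append_nil _).symm (by simp) (by simp)
        (by simp) rfl (by omega)) rfl ?_
      funext k
      cases k <;> simp [store]
    exact .bind hcopy (.pure hcopy.size_le.2)

theorem runs_pushFrame {B M : ℕ} {S : Store} (ht : S .t = []) (hM : ∀ k, (S k).length ≤ M)
    (hB : size S + 10 * M + 2 ≤ B) :
    Runs B pushFrame S () (Function.update (Function.update (Function.update (Function.update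
      (Function.update S .w []) .path (S .w ++ S .path)) .delays (.bit false :: S .delays)) .cur [])
      .frames (S .cur ++ .mark :: S .frames)) := by
  have h₁ := hM .w
  have h₂ := hM .path
  have h₃ := hM .delays
  have h₄ := hM .frames
  have h₅ := hM .cur
  refine .bind (runs_transfer (segment_never (S .w)) (by simp) (by simp) (by simp)
    (by simp) ht (by omega)) ?_
  refine .bind (S' := Function.update (Function.update (Function.update S .w []) .path
    (S .w ++ S .path)) .delays (.bit false :: S .delays)) (Runs.cast (.push ?_) rfl (by simp)) ?_
  · iterate 2 refine size_update_add_le ?_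
    simp only [List.length_append, List.length_nil]
    omega
  refine .bind (S' := Function.update (Function.update (Function.update (Function.update S .w [])
    .path (S .w ++ S .path)) .delays (.bit false :: S .delays)) .frames (.mark :: S .frames))
    (Runs.cast (.push ?_) rfl (by simp)) ?_
  · iterate 3 refine size_update_add_le ?_
    simp only [List.length_append, List.length_nil, List.length_cons]
    omega
  refine Runs.cast (runs_transfer (segment_never (S .cur)) (by simp) (by simp) (by simp) (by simp)
    (by simpa using ht) ?_) rfl ?_
  · iterate 4 refine size_update_add_le ?_
    simp only [List.length_append, List.length_nil, List.length_cons]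
    omega
  · funext k
    cases k <;> simp

/-- For an admissible arc, the entire contents of `cur`, the arc followed by the untried rest,
become the new frame. -/
theorem runs_scanBody {B M : ℕ} {c : List (TimeArc G.n)} {fr : List (Frame G.n)} {β : List Bool}
    (hM : ∀ k, (store G l ⟨.scan, c, fr, β⟩ k).length ≤ M)
    (hB : size (store G l ⟨.scan, c, fr, β⟩) + 20 * M + 2 ≤ B) :
    Runs B scanBody (store G l ⟨.scan, c, fr, β⟩) (Sum.inl (searchStep l ⟨.scan, c, fr, β⟩).mode)
      (store G l (searchStep l ⟨.scan, c, fr, β⟩)) := by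
  refine .bind (runs_isEmpty _ _ (by omega)) ?_
  cases c with
  | nil =>
    rw [show (store G l ⟨.scan, [], fr, β⟩ .cur).isEmpty = true from rfl, if_pos rfl]
    simp only [searchStep]
    exact .pure (show size (store G l ⟨.scan, [], fr, β⟩) ≤ B by omega)
  | cons e rest =>
    obtain ⟨fs, hfs, hvis⟩ := exists_store_path (l := l) .scan (e :: rest) fr β
    obtain ⟨f₁, f₂, f₃, f₄, r, hfr, htime⟩ := exists_store_frames (l := l) .scan (e :: rest) fr β
    have hcur : store G l ⟨.scan, e :: rest, fr, β⟩ .cur = field e.src ++ (field e.dst ++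
        (field e.time ++ (field e.trav ++ rest.flatMap arcLetters))) := by
      simp [store, arcLetters]
    have hlen := hM .cur
    rw [if_neg (by
      rw [List.isEmpty_iff, hcur]
      simp [field_ne_nil])]
    have hcheck := runs_checkArc (B := B) (M := M) (d := G.δ) hcur hfr hfs rfl (idle_store _) rfl
      rfl rfl hM (by omega)
    rw [htime] at hcheck
    rw [hcur] at hlen
    simp only [List.length_append] at hlen
    by_cases ha : Admissible (framesPosition G fr) e
    · rw [decide_eq_true ⟨congrArg Fin.val ha.1, ha.2.1, fun h => ha.2.2 ((hvis _).1 h)⟩] at hcheck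
      refine .bind hcheck ?_
      rw [if_pos rfl]
      simp only [searchStep, if_pos ha]
      have hpush := runs_pushFrame (B := B) (M := M)
        (S := Function.update (store G l ⟨.scan, e :: rest, fr, β⟩) .w (field e.dst)) rfl (by
          intro k
          by_cases hk : k = .w
          · subst hk
            rw [Function.update_self]
            omega
          · rw [Function.update_of_ne hk]
            exact hM k) (by
          have := size_update_le (B := size (store G l ⟨.scan, e :: rest, fr, β⟩) + M) (k := .w)
            (l := field e.dst) (S := store G l ⟨.scan, e :: rest, fr, β⟩) (by omega)
          omega)
      refine Runs.cast (.bind hpush (.pure hpush.size_le.2)) rfl ?_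
      funext k
      cases k <;> simp [store, frameLetters]
    · rw [decide_eq_false fun h => ha ⟨Fin.val_inj.1 h.1, h.2.1, fun h' => h.2.2 ((hvis _).2 h')⟩]
        at hcheck
      refine .bind hcheck ?_
      rw [if_neg (by simp)]
      simp only [searchStep, if_neg ha]
      have hclear := runs_clear (B := B) .w
        (Function.update (store G l ⟨.scan, e :: rest, fr, β⟩) .w (field e.dst)) hcheck.size_le.2
      have hdrop := runs_dropArc (B := B) (e := e) (r := rest.flatMap arcLetters)
        (S := Function.update (Function.update (store G l ⟨.scan, e :: rest, fr, β⟩) .w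
          (field e.dst)) .w []) rfl hclear.size_le.2
      refine Runs.cast (.bind hclear (.bind hdrop (.pure hdrop.size_le.2))) rfl ?_
      funext k
      cases k <;> simp [store]

/-- Arcs consist of bits and separators only, so the first mark is the end of the frame. -/
theorem segment_frame (f : Frame G.n) (r : List Letter) : Segment isMark (frameLetters f) r := by
  have key : ∀ l : List Letter, (∀ s ∈ l, isMark s = false) → Segment isMark (l ++ [.mark]) r := by
    intro l hl
    induction l with
    | nil => exact .last rfl
    | cons s l ih =>
      exact .cons (hl s List.mem_cons_self) (ih fun s hs => hl s (List.mem_cons_of_mem _ hs))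
  have hfield : ∀ m, ∀ s ∈ field m, isMark s = false := by
    intro m s hs
    simp only [field, List.mem_append, List.mem_map, List.mem_singleton] at hs
    rcases hs with ⟨b, -, rfl⟩ | rfl <;> rfl
  have harc : ∀ e : TimeArc G.n, ∀ s ∈ arcLetters e, isMark s = false := by
    intro e s hs
    simp only [arcLetters, List.mem_append] at hs
    rcases hs with hs | hs | hs | hs <;> exact hfield _ s hs
  refine key _ fun s hs => ?_
  rcases List.mem_append.1 hs with hs | hs
  · exact harc _ s hs
  · obtain ⟨e, -, hs⟩ := List.mem_flatMap.1 hs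
    exact harc e s hs

/-- The delay bit has already been popped when this is called, hence the update of `delays`. The
mode `m` is arbitrary because `store` does not depend on it. -/
theorem runs_leave {B M : ℕ} {b d : Bool} {e : TimeArc G.n} {rest : List (TimeArc G.n)}
    {fr : List (Frame G.n)} {β : List Bool} {m : Mode} {S : Store}
    (hS : S = Function.update (store G l ⟨m, [], (d, e, rest) :: fr, β⟩) .delays
      (fr.map fun f => .bit f.1)) (hM : (S .frames).length ≤ M) (hB : size S + 10 * M ≤ B) :
    Runs B (leave b) S (Sum.inl (back b rest fr β).mode) (store G l (back b rest fr β)) := by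
  have hpath : S .path = field e.dst ++ store G l ⟨m, [], fr, β⟩ .path := by
    simp [hS, store]
  have hframes : S .frames = frameLetters (d, e, rest) ++ store G l ⟨m, [], fr, β⟩ .frames := by
    simp [hS, store]
  have hlen := hM
  rw [hframes, List.length_append] at hlen
  have h₁ := runs_drop (B := B) (segment_field e.dst _) hpath (by omega)
  have hs₁ := size_update S .path (store G l ⟨m, [], fr, β⟩ .path)
  rw [hpath, List.length_append] at hs₁
  refine .bind h₁ ?_
  refine .bind (S' := Function.update (Function.update (Function.update S .path
    (store G l ⟨m, [], fr, β⟩ .path)) .frames (store G l ⟨m, [], fr, β⟩ .frames)) .t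
    (frameLetters (d, e, rest)).reverse) (Runs.cast (runs_move (segment_frame _ _)
    (by simpa using hframes) (by simp) (by omega)) rfl (by simp [hS, store])) ?_
  -- Reversal brings the mark to the top of `t`, where a single pop removes it.
  have hu : (frameLetters (d, e, rest)).reverse =
      .mark :: (arcLetters e ++ rest.flatMap arcLetters).reverse := by
    simp [frameLetters]
  have hn : (arcLetters e ++ rest.flatMap arcLetters).length + 1 =
      (frameLetters (d, e, rest)).length := by
    simp [frameLetters]
    omega
  have hle : (store G l ⟨m, [], fr, β⟩ .path).length ≤ (S .path).length := by
    rw [hpath, List.length_append]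
    omega
  refine .bind (S' := Function.update (Function.update (Function.update S .path
    (store G l ⟨m, [], fr, β⟩ .path)) .frames (store G l ⟨m, [], fr, β⟩ .frames)) .t
    (arcLetters e ++ rest.flatMap arcLetters).reverse) (Runs.cast (.pop ?_) rfl (by simp [hu])) ?_
  · refine size_update_le (size_update_add_le ?_)
    rw [List.length_reverse]
    omega
  refine .bind (S' := Function.update (Function.update (Function.update S .path
    (store G l ⟨m, [], fr, β⟩ .path)) .frames (store G l ⟨m, [], fr, β⟩ .frames)) .cur
    (arcLetters e ++ rest.flatMap arcLetters)) (Runs.cast (runs_move (segment_never _)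
      (by simp; rfl) (by simp) ?_) rfl ?_) ?_
  · iterate 2 refine size_update_add_le ?_
    simp only [← List.reverse_append, List.length_reverse]
    omega
  · funext k
    cases k <;> simp [hS, store]
  have hdrop := runs_dropArc (B := B) (e := e) (r := rest.flatMap arcLetters)
    (S := Function.update (Function.update (Function.update S .path
    (store G l ⟨m, [], fr, β⟩ .path)) .frames (store G l ⟨m, [], fr, β⟩ .frames)) .cur
    (arcLetters e ++ rest.flatMap arcLetters)) (by simp)
    (size_update_le (size_update_add_le (by omega)))
  refine .bind hdrop ?_
  cases b with
  | true =>
    have hclear := runs_clear (B := B) .cur _ hdrop.size_le.2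
    refine Runs.cast (.bind hclear (.pure hclear.size_le.2)) rfl ?_
    subst hS
    funext k
    cases k <;> simp [store, back]
  | false =>
    refine Runs.cast (.pure hdrop.size_le.2) rfl ?_
    subst hS
    funext k
    cases k <;> simp [store, back]

theorem runs_retBody {B M : ℕ} {b : Bool} {c : List (TimeArc G.n)} {fr : List (Frame G.n)}
    {β : List Bool} (hc : c = []) (hfr : fr ≠ [])
    (hM : ∀ k, (store G l ⟨.ret b, c, fr, β⟩ k).length ≤ M)
    (hB : size (store G l ⟨.ret b, c, fr, β⟩) + 15 * M ≤ B) :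
    Runs B (retBody b) (store G l ⟨.ret b, c, fr, β⟩)
      (Sum.inl (searchStep l ⟨.ret b, c, fr, β⟩).mode)
      (store G l (searchStep l ⟨.ret b, c, fr, β⟩)) := by
  subst hc
  obtain ⟨⟨d, e, rest⟩, fr, rfl⟩ := List.exists_cons_of_ne_nil hfr
  have hx := hM .x
  have hf := hM .frames
  have hl : β.length + 1 = (store G l ⟨.ret b, [], (d, e, rest) :: fr, β⟩ .x).length := by
    simp [store]
  have hpop : Runs B (Cmd.pop .delays) (store G l ⟨.ret b, [], (d, e, rest) :: fr, β⟩)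
      (some (.bit d)) (Function.update (store G l ⟨.ret b, [], (d, e, rest) :: fr, β⟩) .delays
      (fr.map fun f => .bit f.1)) := .pop (by omega)
  have hs := size_update (store G l ⟨.ret b, [], (d, e, rest) :: fr, β⟩) .delays
      (fr.map fun f => .bit f.1)
  have hd : (store G l ⟨.ret b, [], (d, e, rest) :: fr, β⟩ .delays).length =
      (fr.map fun f => (Letter.bit f.1)).length + 1 := by simp [store]
  refine .bind hpop ?_
  generalize hS : Function.update (store G l ⟨.ret b, [], (d, e, rest) :: fr, β⟩) .delays
    (fr.map fun f => .bit f.1) = S at hpop hs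
  have hSx : S .x = β.map .bit ++ [.sep] := by simp [← hS, store]
  have hSt : S .t = [] := by simp [← hS, store]
  have hSf : S .frames = store G l ⟨.ret b, [], (d, e, rest) :: fr, β⟩ .frames := by
    simp [← hS, store]
  have hbump (b' : Bool) := runs_bumpCounter (B := B) b' β S hSx hSt (by omega)
  have hs' := size_update S .x ((bump true true β).1.map .bit ++ [.sep])
  cases d with
  | true =>
    dsimp only
    rw [if_pos rfl]
    refine .bind (hbump true) ?_
    simp only [searchStep]
    refine runs_leave (m := .ret b) (M := M) (d := true) (e := e) ?_ ?_ ?_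
    · rw [← hS]
      funext k
      cases k <;> simp [store]
    · simpa [hSf] using hf
    · refine size_update_add_le ?_
      simp only [List.length_append, List.length_map, length_bump, List.length_singleton]
      omega
  | false =>
    dsimp only
    rw [if_neg (show Letter.bit false ≠ .bit true by simp)]
    cases b with
    | false =>
      rw [if_neg (show ¬ false = true by simp)]
      simp only [searchStep]
      exact runs_leave (m := .ret false) (M := M) hS.symm (by simpa [hSf] using hf) (by omega)
    | true =>
      rw [if_pos rfl]
      refine .bind (hbump false) ?_
      -- A borrow left over means that the budget was zero; the wrapped counter is incremented back
      -- to `β`.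
      by_cases hcarry : (bump false true β).2 = true
      · rw [if_pos hcarry]
        simp only [searchStep, if_pos hcarry]
        have hs := size_update S .x ((bump false true β).1.map .bit ++ [.sep])
        rw [hSx] at hs
        simp only [List.length_append, List.length_map, length_bump, List.length_singleton] at hs
        have hb := runs_bumpCounter (B := B) true (bump false true β).1
          (Function.update S .x ((bump false true β).1.map .bit ++ [.sep]))
          (Function.update_self ..) (by simpa using hSt) (by rw [length_bump]; omega)
        rw [increment_decrement, Function.update_idem, ← hSx, Function.update_eq_self] at hb
        refine .bind hb ?_
        exact runs_leave (m := .ret true) (M := M) hS.symm (by simpa [hSf] using hf) (by omega)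
      · rw [if_neg hcarry]
        simp only [searchStep, if_neg hcarry]
        have hp : Runs B (Cmd.push .delays (.bit true))
            (Function.update S .x ((bump false true β).1.map .bit ++ [.sep])) ()
            (store G l ⟨.down, [], (true, e, rest) :: fr, (bump false true β).1⟩) := by
          refine Runs.cast (.push (size_update_add_le ?_)) rfl ?_
          · simp only [List.length_append, List.length_map, length_bump, List.length_singleton]
            omega
          · rw [← hS]
            funext k
            cases k <;> simp [store, frameLetters]
        exact .bind hp (.pure hp.size_le.2)

/-! ### The polynomial space bound and the run of the whole search -/

theorem length_flatMap_le_of_suffix {α β : Type} (f : α → List β) {l₁ l₂ : List α}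
    (h : l₁ <:+ l₂) : (l₁.flatMap f).length ≤ (l₂.flatMap f).length := by
  obtain ⟨l, rfl⟩ := h
  simp

theorem length_flatMap_le {α β : Type} (f : α → List β) (l : List α) (n : ℕ)
    (h : ∀ a ∈ l, (f a).length ≤ n) : (l.flatMap f).length ≤ l.length * n := by
  induction l with
  | nil => simp
  | cons a l ih =>
    have h₁ := h a List.mem_cons_self
    have h₂ := ih fun b hb => h b (List.mem_cons_of_mem _ hb)
    rw [List.flatMap_cons, List.length_append, List.length_cons, Nat.succ_mul]
    omega

theorem length_le_length_flatMap_arcLetters {n : ℕ} (l : List (TimeArc n)) :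
    l.length ≤ (l.flatMap arcLetters).length := by
  induction l with
  | nil => simp
  | cons e l ih =>
    have : 0 < (arcLetters e).length := by simp [arcLetters, field]
    rw [List.flatMap_cons, List.length_append, List.length_cons]
    omega

/-- There are at most `N` frames, and each is the encoding of a suffix of `l` plus a mark, hence at
most `N + 1` letters. The extra `N` covers the single numbers and arc lists, the `4` the zeros below
the frames. -/
theorem length_store_le {k N : ℕ} {s : Search G.n} (hs : s.Valid l k)
    (hN : (field G.n).length + (field G.s).length + (field G.z).length + (k + 1) +
      (field G.δ).length + (l.flatMap arcLetters).length ≤ N) (j : Stk) :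
    (store G l s j).length ≤ N * (N + 1) + N + 4 := by
  have hl := length_le_length_flatMap_arcLetters l
  have hfr := hs.length_frames_le
  have hcur := length_flatMap_le_of_suffix arcLetters hs.cur_suffix
  have hframe (f : Frame G.n) (hf : f ∈ s.frames) : (frameLetters f).length ≤ N + 1 ∧
      (field f.2.1.dst).length ≤ N + 1 := by
    have := length_flatMap_le_of_suffix arcLetters (hs.frames_suffix f hf)
    simp only [List.flatMap_cons, List.length_append, frameLetters, List.length_singleton,
      arcLetters] at this ⊢
    omega
  have h₁ := length_flatMap_le frameLetters s.frames (N + 1) fun f hf => (hframe f hf).1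
  have h₂ := length_flatMap_le (fun f => field f.2.1.dst) s.frames (N + 1)
    fun f hf => (hframe f hf).2
  have h₃ : s.frames.length * (N + 1) ≤ N * (N + 1) := Nat.mul_le_mul_right _ (by omega)
  have h₄ : (field 0).length = 1 := rfl
  have h₅ : s.frames.length ≤ N := by omega
  have h₆ := hs.length_budget
  cases j <;>
    simp only [store, List.length_append, List.length_map, List.length_singleton, List.length_nil] <;>
    omega

theorem size_le {S : Store} {M : ℕ} (h : ∀ k, (S k).length ≤ M) : size S ≤ 17 * M := by
  refine (Finset.sum_le_card_nsmul Finset.univ _ M fun k _ => h k).trans_eq ?_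
  rfl

/-- Each abstract step is one iteration of the loop; in the final state `delays` is empty, which
makes the loop exit. With `M` the bound on one stack, `17 * M` for the contents and at most `20 * M
+ 2` of working space fit into `40 * M`. -/
theorem exists_runs_search {B k N : ℕ} {s : Search G.n} {b : Bool} {β : List Bool}
    (h : Relation.ReflTransGen (ValidStep l k) s ⟨.ret b, [], [], β⟩) (hβ : β.length = k)
    (hN : (field G.n).length + (field G.s).length + (field G.z).length + (k + 1) +
      (field G.δ).length + (l.flatMap arcLetters).length ≤ N)
    (hB : 40 * (N * (N + 1) + N + 4) ≤ B) :
    ∃ S', Runs B (.iter searchBody s.mode) (store G l s) b S' := by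
  induction h using Relation.ReflTransGen.head_induction_on with
  | refl =>
    have hM := length_store_le (s := ⟨.ret b, [], [], β⟩)
      (ValidFrames.valid (l := l) ⟨by simp, by simp⟩ hβ (.ret b)) hN
    have hs := size_le hM
    have := size_tail_le (store G l ⟨.ret b, [], [], β⟩) .delays
    exact ⟨_, .exit (.bind (.pop (by omega)) (.pure (by omega)))⟩
  | @head s s' hstep _ ih =>
    obtain ⟨S', ih⟩ := ih
    obtain ⟨hv, hf, rfl⟩ := hstep
    have hM := length_store_le hv hN
    have hs := size_le hM
    obtain ⟨m, c, fr, γ⟩ := s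
    refine ⟨S', .next ?_ ih⟩
    cases m with
    | down => exact runs_downBody (hv.cur_eq_nil (by simp)) hM (by omega)
    | scan => exact runs_scanBody hM (by omega)
    | ret b' => exact runs_retBody (hv.cur_eq_nil (by simp)) (hf b' rfl) hM (by omega)

open Classical in
theorem exists_runs_search_start {B N : ℕ} (hl : ∀ e, e ∈ l ↔ e ∈ G.arcs)
    (hN : (field G.n).length + (field G.s).length + (field G.z).length + (field G.x).length +
      (field G.δ).length + (l.flatMap arcLetters).length ≤ N)
    (hB : 40 * (N * (N + 1) + N + 4) ≤ B) :
    ∃ S', Runs B search (store G l ⟨.down, [], [], Computability.encodeNat G.x⟩)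
      (decide G.TravelerWins) S' := by
  have := search_down hl (k := (Computability.encodeNat G.x).length)
    ((framesPosition G []).unvisited + 1) [] _ (Nat.lt_succ_self _) ⟨by simp, by simp⟩ rfl
    (bitsValue_encodeNat G.x)
  obtain ⟨S', h⟩ := exists_runs_search this rfl (by simpa [field] using hN) hB
  exact ⟨S', Runs.cast h (by rw [travelerWins_iff]; rfl) rfl⟩

end Prog

/-! ### Well-formed words -/

namespace Prog

open Cmd Letter PathGame

/-- The symbol of the input as a letter. -/
def ofInput : Option Bool → Letter
  | none => .sep
  | some b => .bit b

/-- The next state when a word is read from its end. The first component is `0` at the start, `1`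
after a separator and `2` after a bit; the second one counts the separators, where from `5` on only
the remainder modulo `4` counts; and `none` means that the word is no list of numbers. -/
def wordStep (q : Option (Fin 3 × Fin 9)) (s : Letter) : Option (Fin 3 × Fin 9) :=
  match q, s with
  | some (_, c), .sep => some (1, if c = 8 then 5 else c + 1)
  | some (1, c), .bit true => some (2, c)
  | some (2, c), .bit _ => some (2, c)
  | _, _ => none

/-- The state after reading a word from its end. -/
def wordState (w : List (Option Bool)) : Option (Fin 3 × Fin 9) :=
  w.foldr (fun x q => wordStep q (ofInput x)) (some (0, 0))

/-- The state of the counter after `k` separators. -/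
def sepCount (k : ℕ) : Fin 9 := if h : k < 5 then ⟨k, by omega⟩ else ⟨5 + (k - 5) % 4, by omega⟩

theorem sepCount_succ (k : ℕ) :
    sepCount (k + 1) = if sepCount k = 8 then 5 else sepCount k + 1 := by
  unfold sepCount
  by_cases h : k + 1 < 5
  · have : k < 5 := by omega
    rw [dif_pos h, dif_pos this]
    interval_cases k <;> rfl
  · rw [dif_neg h]
    by_cases h' : k < 5
    · have : k = 4 := by omega
      subst this
      rfl
    · have e : (k + 1 - 5) % 4 = ((k - 5) % 4 + 1) % 4 := by omega
      have key (r : ℕ) (hr : r < 4) : (⟨5 + (r + 1) % 4, by omega⟩ : Fin 9) =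
          if (⟨5 + r, by omega⟩ : Fin 9) = 8 then 5 else ⟨5 + r, by omega⟩ + 1 := by
        interval_cases r <;> rfl
      simp only [e, dif_neg h']
      exact key _ (Nat.mod_lt _ (by norm_num))

theorem sepCount_eq_five_iff (k : ℕ) : sepCount k = 5 ↔ ∃ m, k = 5 + 4 * m := by
  unfold sepCount
  split_ifs with h
  · rw [Fin.ext_iff]
    change k = 5 ↔ _
    omega
  · rw [Fin.ext_iff]
    change 5 + (k - 5) % 4 = 5 ↔ _
    constructor
    · intro h
      exact ⟨(k - 5) / 4, by omega⟩
    · rintro ⟨m, rfl⟩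
      omega

theorem encodeNats_cons (m : ℕ) (l : List ℕ) :
    encodeNats (m :: l) = (Computability.encodeNat m).map some ++ none :: encodeNats l := by
  simp [encodeNats]

/-- Read from its end, a canonical number starts with its most significant bit, which must be `1`;
so the absence of superfluous zeros is a condition on the letter next to a separator. -/
theorem wordState_encodeNats (l : List ℕ) :
    ∃ p, wordState (encodeNats l) = some (p, sepCount l.length) := by
  induction l with
  | nil => exact ⟨0, rfl⟩
  | cons m l ih =>
    obtain ⟨p, hp⟩ := ih
    have h0 : wordState (none :: encodeNats l) = some (1, sepCount (m :: l).length) := by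
      change wordStep (wordState (encodeNats l)) .sep = _
      rw [hp, List.length_cons, sepCount_succ]
      rfl
    rw [encodeNats_cons]
    unfold Computability.encodeNat Computability.encodeNum
    cases (m : Num) with
    | zero => exact ⟨1, h0⟩
    | pos n =>
      refine ⟨2, ?_⟩
      induction n with
      | one =>
        change wordStep (wordState (none :: encodeNats l)) (.bit true) = _
        rw [h0]
        rfl
      | bit0 n ihn =>
        change wordStep (wordState ((Computability.encodePosNum n).map some ++
          none :: encodeNats l)) (.bit false) = _
        have ihn : wordState ((Computability.encodePosNum n).map some ++ none :: encodeNats l) =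
          some (2, sepCount (m :: l).length) := ihn
        rw [ihn]
        rfl
      | bit1 n ihn =>
        change wordStep (wordState ((Computability.encodePosNum n).map some ++
          none :: encodeNats l)) (.bit true) = _
        have ihn : wordState ((Computability.encodePosNum n).map some ++ none :: encodeNats l) =
          some (2, sepCount (m :: l).length) := ihn
        rw [ihn]
        rfl

/-- A new lowest bit doubles the number and adds `b`; only the lone digit `0` would not be
canonical. -/
theorem exists_encodeNat_cons (b : Bool) (m : ℕ) (h : Computability.encodeNat m ≠ [] ∨ b = true) :
    ∃ m', Computability.encodeNat m' = b :: Computability.encodeNat m := by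
  unfold Computability.encodeNat at *
  generalize (m : Num) = n at *
  have key (p : PosNum) : ((((Num.pos p : Num) : ℕ) : Num)) = Num.pos p := Num.of_to_nat _
  cases n with
  | zero =>
    have hb : b = true := h.resolve_left fun h => h rfl
    exact ⟨1, by subst hb; rfl⟩
  | pos p =>
    cases b with
    | false => exact ⟨((Num.pos p.bit0 : Num) : ℕ), by rw [key]; rfl⟩
    | true => exact ⟨((Num.pos p.bit1 : Num) : ℕ), by rw [key]; rfl⟩

/-- Converse of the previous analysis: a separator starts a new number `0`, and a bit accepted by
the automaton extends the first number. State `2` records that this number is already nonempty, so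
any bit may follow. -/
theorem exists_encodeNats_of_wordState (w : List (Option Bool)) :
    ∀ p c, wordState w = some (p, c) → (w = [] ∧ p = 0 ∧ c = sepCount 0) ∨
      ∃ m l, w = encodeNats (m :: l) ∧ c = sepCount (m :: l).length ∧
        (p = 1 ∨ p = 2 ∧ Computability.encodeNat m ≠ []) := by
  induction w with
  | nil =>
    intro p c h
    simp only [wordState, List.foldr_nil, Option.some.injEq, Prod.mk.injEq] at h
    exact .inl ⟨rfl, h.1.symm, h.2.symm⟩
  | cons x w ih =>
    intro p c h
    change wordStep (wordState w) (ofInput x) = _ at h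
    rcases hw : wordState w with _ | ⟨p', c'⟩
    · rw [hw] at h
      simp [wordStep] at h
    specialize ih p' c' hw
    rw [hw] at h
    right
    cases x with
    | none =>
      simp only [ofInput, wordStep, Option.some.injEq, Prod.mk.injEq] at h
      rcases ih with ⟨rfl, -, rfl⟩ | ⟨m, l, rfl, rfl, -⟩
      · exact ⟨0, [], rfl, h.2.symm, .inl h.1.symm⟩
      · exact ⟨0, m :: l, rfl, h.2.symm.trans (sepCount_succ _).symm, .inl h.1.symm⟩
    | some b =>
      rcases ih with ⟨-, rfl, -⟩ | ⟨m, l, rfl, hc, hp⟩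
      · cases b <;> simp [ofInput, wordStep] at h
      have hb : Computability.encodeNat m ≠ [] ∨ b = true := by
        rcases hp with rfl | hp
        · cases b
          · simp [ofInput, wordStep] at h
          · exact .inr rfl
        · exact .inl hp.2
      have hq : p = 2 ∧ c = c' := by
        rcases hp with rfl | ⟨rfl, -⟩ <;> cases b <;> simp_all [ofInput, wordStep]
      obtain ⟨m', hm'⟩ := exists_encodeNat_cons b m hb
      refine ⟨m', l, ?_, ?_, .inr ⟨hq.1, by simp [hm']⟩⟩
      · rw [encodeNats_cons, encodeNats_cons, hm']
        rfl
      · rw [hq.2, hc]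
        rfl

/-- Whether the state means that the word is a list of `5 + 4 * m` numbers. -/
def wordAccepts (q : Option (Fin 3 × Fin 9)) : Bool := q.any fun q => q.2 == 5

theorem wordAccepts_iff (w : List (Option Bool)) :
    wordAccepts (wordState w) = true ↔ ∃ l m, w = encodeNats l ∧ l.length = 5 + 4 * m := by
  constructor
  · intro h
    rcases hw : wordState w with _ | ⟨p, c⟩
    · simp [hw, wordAccepts] at h
    rw [hw] at h
    simp only [wordAccepts, Option.any_some, beq_iff_eq] at h
    subst h
    rcases exists_encodeNats_of_wordState w p _ hw with ⟨-, -, h⟩ | ⟨m, l, rfl, h, -⟩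
    · exact absurd h.symm (by rw [sepCount_eq_five_iff]; omega)
    · obtain ⟨k, hk⟩ := (sepCount_eq_five_iff _).1 h.symm
      exact ⟨_, k, rfl, hk⟩
  · rintro ⟨l, m, rfl, hl⟩
    obtain ⟨p, hp⟩ := wordState_encodeNats l
    rw [hp, wordAccepts]
    simpa using (sepCount_eq_five_iff _).2 ⟨m, hl⟩

/-! ### Unique decoding -/

theorem map_some_append_none_inj {f g : List Bool} {u v : List (Option Bool)}
    (h : f.map some ++ none :: u = g.map some ++ none :: v) : f = g ∧ u = v := by
  induction f generalizing g with
  | nil =>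
    cases g with
    | nil => simpa using h
    | cons b g => simp at h
  | cons a f ih =>
    cases g with
    | nil => simp at h
    | cons b g =>
      simp only [List.map_cons, List.cons_append, List.cons.injEq, Option.some.injEq] at h
      obtain ⟨rfl, rfl⟩ := ih h.2
      exact ⟨by rw [h.1], rfl⟩

theorem encodeNats_injective : Function.Injective encodeNats := by
  intro l
  induction l with
  | nil =>
    rintro (_ | ⟨m, l⟩) h
    · rfl
    · rw [encodeNats_cons] at h
      simp [encodeNats] at h
  | cons m l ih =>
    rintro (_ | ⟨m', l'⟩) h
    · rw [encodeNats_cons] at h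
      simp [encodeNats] at h
    · rw [encodeNats_cons, encodeNats_cons] at h
      obtain ⟨h₁, h₂⟩ := map_some_append_none_inj h
      rw [ih h₂, ← Computability.decode_encodeNat m, h₁, Computability.decode_encodeNat]

/-- The entries of a time arc. -/
def entries {n : ℕ} (e : TimeArc n) : ℕ × ℕ × ℕ × ℕ := (e.src, e.dst, e.time, e.trav)

/-- The entries of a quadruple as a list. -/
def quad (q : ℕ × ℕ × ℕ × ℕ) : List ℕ := [q.1, q.2.1, q.2.2.1, q.2.2.2]

theorem flatMap_quad_injective : Function.Injective fun qs => List.flatMap quad qs := by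
  intro l
  induction l with
  | nil => rintro (_ | ⟨q, l⟩) h <;> simp_all [quad]
  | cons q l ih =>
    rintro (_ | ⟨q', l'⟩) h
    · simp [quad] at h
    · simp only [List.flatMap_cons, quad, List.cons_append, List.nil_append, List.cons.injEq] at h
      obtain ⟨h₁, h₂, h₃, h₄, h⟩ := h
      rw [ih h, show q = q' from Prod.ext h₁ (Prod.ext h₂ (Prod.ext h₃ h₄))]

theorem exists_flatMap_quad (m : ℕ) : ∀ l : List ℕ, l.length = 4 * m →
    ∃ qs : List (ℕ × ℕ × ℕ × ℕ),
    l = qs.flatMap quad := by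
  induction m with
  | zero => exact fun l hl => ⟨[], List.eq_nil_of_length_eq_zero hl⟩
  | succ m ih =>
    intro l hl
    match l, hl with
    | a :: b :: c :: d :: l, hl =>
      obtain ⟨qs, rfl⟩ := ih l (by simp at hl; omega)
      exact ⟨(a, b, c, d) :: qs, rfl⟩

theorem isEncoding_iff (G : PathGame) (w : List (Option Bool)) :
    G.IsEncoding w ↔ ∃ l : List (TimeArc G.n), (∀ e, e ∈ l ↔ e ∈ G.arcs) ∧
      w = encodeNats ([G.n, (G.s : ℕ), (G.z : ℕ), G.x, G.δ] ++ (l.map entries).flatMap quad) := by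
  simp only [PathGame.IsEncoding, List.flatMap_map]
  rfl

theorem entries_injective {n : ℕ} : Function.Injective (entries (n := n)) := by
  rintro ⟨a, b, c, d⟩ ⟨a', b', c', d'⟩ h
  simp only [entries, Prod.mk.injEq, Fin.val_inj] at h
  obtain ⟨rfl, rfl, rfl, rfl⟩ := h
  rfl

/-- The word determines the list of arcs, and the list determines the set. Since membership in the
language asks for some encoded yes-instance, this is what justifies rejecting when the decoded one
is a no-instance. -/
theorem eq_of_isEncoding {G G' : PathGame} {w : List (Option Bool)} (h : G.IsEncoding w)
    (h' : G'.IsEncoding w) : G = G' := by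
  rw [isEncoding_iff] at h h'
  obtain ⟨l, hl, rfl⟩ := h
  obtain ⟨l', hl', h⟩ := h'
  have h := encodeNats_injective h
  obtain ⟨n, arcs, s, z, x, δ⟩ := G
  obtain ⟨n', arcs', s', z', x', δ'⟩ := G'
  simp only [List.cons_append, List.nil_append, List.cons.injEq] at h
  obtain ⟨rfl, hs, hz, rfl, rfl, h⟩ := h
  obtain rfl := Fin.ext hs
  obtain rfl := Fin.ext hz
  obtain rfl := List.map_injective_iff.2 entries_injective (flatMap_quad_injective h)
  congr
  ext e
  rw [← hl, ← hl']

end Prog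

/-! ### The decision procedure -/

namespace Prog

open Cmd Letter PathGame

/-- Moves the input, which is given in reverse order on the stack `t`, to the stack `arcs`, and
returns the state of the check for well-formedness. -/
def readWord : Prog (Option (Fin 3 × Fin 9)) :=
  .iter (fun q => (Cmd.pop .t).bind fun s =>
    match s with
    | none => .pure (Sum.inr q)
    | some s => (Cmd.push .arcs s).bind fun _ => .pure (Sum.inl (wordStep q s)))
    (some (0, 0))

theorem runs_readWord_from {B : ℕ} (q : Option (Fin 3 × Fin 9)) (u : List Letter) {S : Store}
    (hu : S .t = u) (hB : size S ≤ B) :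
    Runs B (.iter (fun q => (Cmd.pop .t).bind fun s =>
      match s with
      | none => .pure (Sum.inr q)
      | some s => (Cmd.push .arcs s).bind fun _ => .pure (Sum.inl (wordStep q s))) q : Prog _) S
      (u.foldl wordStep q) (Function.update (Function.update S .t []) .arcs
        (u.reverse ++ S .arcs)) := by
  induction u generalizing q S with
  | nil =>
    refine .exit (.bind (.pop hB) ?_)
    have e : Function.update S .t [] = S := by rw [← hu, Function.update_eq_self]
    rw [hu, List.head?_nil, List.tail_nil, e]
    exact Runs.cast (.pure hB) rfl (by simp)
  | cons s u ih =>
    have h₁ := size_update S .t u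
    have h₂ := size_update (Function.update S .t u) .arcs (s :: S .arcs)
    simp only [hu, List.length_cons, ne_eq, reduceCtorEq, not_false_eq_true,
      Function.update_of_ne] at h₁ h₂
    refine .next (t' := wordStep q s) (S' := Function.update (Function.update S .t u) .arcs
      (s :: S .arcs)) (.bind (.pop hB) ?_)
      (Runs.cast (ih _ (by simp) (by omega)) rfl ?_)
    · rw [hu]
      refine .bind (a := ()) (Runs.cast (.push ?_) rfl ?_) (.pure (by omega))
      · rw [List.tail_cons]
        omega
      · simp
    · funext k
      cases k <;> simp

/-- Loading has reversed the input, so popping visits it from its end, as the automaton requires,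
and pushing restores its order. -/
theorem runs_readWord {B : ℕ} (w : List (Option Bool)) (hB : w.length ≤ B) :
    Runs B readWord (Function.update (fun _ => []) .t (w.map ofInput).reverse) (wordState w)
      (Function.update (fun _ => []) .arcs (w.map ofInput)) := by
  refine Runs.cast (runs_readWord_from (some (0, 0)) _ (Function.update_self ..)
    (size_update_le (by simpa [size] using hB))) ?_ ?_
  · rw [List.foldl_reverse, List.foldr_map]
    rfl
  · funext k
    cases k <;> simp

/-- The numbers of a quadruple on a stack. -/
def quadLetters (q : ℕ × ℕ × ℕ × ℕ) : List Letter :=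
  field q.1 ++ (field q.2.1 ++ (field q.2.2.1 ++ field q.2.2.2))

/-- The loop of `checkArcs`. -/
def checkArcsBody (ok : Bool) : Prog (Bool ⊕ Bool) :=
  (isEmpty .arcs).bind fun b =>
    if b then .pure (Sum.inr ok)
    else
      (compareFields .arcs .n).bind fun o₁ =>
      (drain isSep .arcs [.p]).bind fun _ =>
      (compareFields .arcs .n).bind fun o₂ =>
      (drain isSep .arcs [.p]).bind fun _ =>
      (drain isSep .arcs [.p]).bind fun _ =>
      (drain isSep .arcs [.p]).bind fun _ => .pure (Sum.inl (ok && o₁ == .lt && o₂ == .lt))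

/-- Whether the start and end vertices of all arcs are less than the number of vertices. -/
def checkArcs : Prog Bool :=
  (Cmd.iter checkArcsBody true).bind fun ok =>
  (drain (fun _ => false) .p [.arcs]).bind fun _ => .pure ok

theorem length_le_size (S : Store) (k : Stk) : (S k).length ≤ size S :=
  Finset.single_le_sum (f := fun k => (S k).length) (fun _ _ => Nat.zero_le _) (Finset.mem_univ k)

/-- Stated with an unnamed final store and only the facts needed about it, so that four successive
moves do not build up nested updates. -/
theorem exists_runs_advance {B N f : ℕ} {r : List Letter} {S : Store}
    (h : S .arcs = field f ++ r) (hN : size S ≤ N) (hB : 2 * N ≤ B) :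
    ∃ T, Runs B (drain isSep .arcs [.p]) S () T ∧ T .arcs = r ∧
      T .p = (field f).reverse ++ S .p ∧ (∀ k, k ≠ .arcs → k ≠ .p → T k = S k) ∧ size T ≤ N := by
  have h₁ := size_update S .arcs r
  have h₂ := size_update (Function.update S .arcs r) .p ((field f).reverse ++ S .p)
  have hl := length_le_size S .arcs
  simp only [h, List.length_append, List.length_reverse, ne_eq, reduceCtorEq, not_false_eq_true,
    Function.update_of_ne] at h₁ h₂ hl
  exact ⟨_, runs_move (segment_field f r) h (by simp) (by omega), by simp, by simp,
    fun k h h' => by simp [h, h'], by omega⟩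

theorem runs_checkArcs_loop {B N n : ℕ} (ok : Bool) (qs : List (ℕ × ℕ × ℕ × ℕ)) {S : Store}
    (harcs : S .arcs = qs.flatMap quadLetters) (hn : S .n = field n) (hS : Idle S)
    (hN : size S ≤ N) (hB : 10 * N ≤ B) :
    Runs B (.iter checkArcsBody ok) S (ok && qs.all fun q => q.1 < n && q.2.1 < n)
      (Function.update (Function.update S .arcs []) .p ((S .arcs).reverse ++ S .p)) := by
  induction qs generalizing ok S with
  | nil =>
    rw [List.flatMap_nil] at harcs
    refine .exit (.bind (runs_isEmpty _ _ (by omega)) ?_)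
    rw [harcs, List.isEmpty_nil, if_pos rfl]
    refine Runs.cast (.pure (by omega)) (by simp) ?_
    rw [← harcs, Function.update_eq_self, harcs, List.reverse_nil, List.nil_append,
      Function.update_eq_self]
  | cons q qs ih =>
    obtain ⟨v, w, t, u⟩ := q
    have h₀ : S .arcs = field v ++ (field w ++ (field t ++ (field u ++
      qs.flatMap quadLetters))) := by simp [harcs, quadLetters]
    obtain ⟨S₁, run₁, arcs₁, p₁, eq₁, size₁⟩ := exists_runs_advance (B := B) h₀ hN (by omega)
    obtain ⟨S₂, run₂, arcs₂, p₂, eq₂, size₂⟩ := exists_runs_advance (B := B) arcs₁ size₁ (by omega)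
    obtain ⟨S₃, run₃, arcs₃, p₃, eq₃, size₃⟩ := exists_runs_advance (B := B) arcs₂ size₂ (by omega)
    obtain ⟨S₄, run₄, arcs₄, p₄, eq₄, size₄⟩ := exists_runs_advance (B := B) arcs₃ size₃ (by omega)
    have hl₀ := length_le_size S .arcs
    have hl₁ := length_le_size S .n
    simp only [h₀, hn, List.length_append] at hl₀ hl₁
    have hS₁ : Idle S₁ := by
      simpa [Idle, eq₁] using hS
    have hS₄ : Idle S₄ := by
      simpa [Idle, eq₁, eq₂, eq₃, eq₄] using hS
    refine .next (t' := ok && compare v n == .lt && compare w n == .lt) (S' := S₄)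
      (.bind (runs_isEmpty _ _ (by omega)) ?_)
      (Runs.cast (ih _ arcs₄ (by simpa [eq₁, eq₂, eq₃, eq₄] using hn) hS₄ size₄) ?_ ?_)
    · rw [List.isEmpty_eq_false_iff.2 (by simp [h₀, field_ne_nil])]
      refine .bind (runs_compareFields (r' := []) h₀ (by simpa using hn) hS (by simp) (by simp)
        (by omega)) ?_
      refine .bind run₁ ?_
      refine .bind (runs_compareFields (r' := []) arcs₁ (by simpa [eq₁] using hn) hS₁ (by simp)
        (by simp) (by omega)) ?_
      exact .bind run₂ (.bind run₃ (.bind run₄ (.pure (by omega))))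
    · have hlt (a b : ℕ) : (compare a b == .lt) = decide (a < b) := by
        rw [Bool.eq_iff_iff, beq_iff_eq, compare_lt_iff_lt, decide_eq_true_iff]
      simp [hlt, Bool.and_assoc]
    · funext k
      by_cases hp : k = .p
      · subst hp
        simp [p₄, p₃, p₂, p₁, h₀, arcs₄]
      · by_cases ha : k = .arcs
        · subst ha
          simp
        · simp [hp, ha, eq₁, eq₂, eq₃, eq₄]

theorem runs_checkArcs {B N n : ℕ} {qs : List (ℕ × ℕ × ℕ × ℕ)} {S : Store}
    (harcs : S .arcs = qs.flatMap quadLetters) (hn : S .n = field n) (hS : Idle S)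
    (hp : S .p = []) (hN : size S ≤ N) (hB : 10 * N ≤ B) :
    Runs B checkArcs S (qs.all fun q => q.1 < n && q.2.1 < n) S := by
  have h := runs_checkArcs_loop true qs harcs hn hS hN hB
  rw [hp, List.append_nil] at h
  have hl := length_le_size S .arcs
  refine .bind h (.bind (Runs.cast (runs_move (segment_never _) (by simp; rfl) (by simp) ?_)
    rfl ?_) (.pure (by omega)))
  · refine size_update_add_le (size_update_add_le ?_)
    simp only [List.length_reverse, List.length_nil]
    omega
  · funext k
    cases k <;> simp [hp]

/-- The stacks after reading the numbers of the input. -/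
def inputStore (n s z x δ : ℕ) (qs : List (ℕ × ℕ × ℕ × ℕ)) : Store
  | .n => field n
  | .path => field s
  | .z => field z
  | .x => field x
  | .δ => field δ
  | .arcs => qs.flatMap quadLetters
  | _ => []

theorem size_inputStore (n s z x δ : ℕ) (qs : List (ℕ × ℕ × ℕ × ℕ)) :
    size (inputStore n s z x δ qs) = (field n).length + (field s).length + (field z).length +
      (field x).length + (field δ).length + (qs.flatMap quadLetters).length := by
  have huniv : (Finset.univ : Finset Stk) = {.n, .z, .δ, .x, .arcs, .cur, .path, .frames, .delays,
    .p, .q, .w, .t, .a, .b, .c, .e} := rfl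
  rw [size, huniv]
  simp [inputStore]
  omega

/-- Reads the numbers of the input, and checks that all vertices are less than the number of
vertices. -/
def readNumbers : Prog Bool :=
  (transfer isSep .arcs .n).bind fun _ => (transfer isSep .arcs .path).bind fun _ =>
  (transfer isSep .arcs .z).bind fun _ => (transfer isSep .arcs .x).bind fun _ =>
  (transfer isSep .arcs .δ).bind fun _ =>
  (compareFields .path .n).bind fun o₁ => (compareFields .z .n).bind fun o₂ =>
  checkArcs.bind fun b => .pure (o₁ == .lt && o₂ == .lt && b)

theorem runs_readNumbers {B N n s z x δ : ℕ} {qs : List (ℕ × ℕ × ℕ × ℕ)} {S : Store}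
    (hS : S = Function.update (fun _ => []) .arcs (field n ++ (field s ++ (field z ++ (field x ++
      (field δ ++ qs.flatMap quadLetters))))))
    (hN : (S .arcs).length ≤ N) (hB : 20 * N ≤ B) :
    Runs B readNumbers S (decide (s < n) && decide (z < n) && qs.all fun q => q.1 < n && q.2.1 < n)
      (inputStore n s z x δ qs) := by
  have h₀ : S .arcs = field n ++ (field s ++ (field z ++ (field x ++
      (field δ ++ qs.flatMap quadLetters)))) := by simp [hS]
  have hsize : size S = (S .arcs).length := by
    subst hS
    have := size_update (fun _ : Stk => ([] : List Letter)) Stk.arcs (field n ++ (field s ++ (field z ++ (field x ++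
      (field δ ++ qs.flatMap quadLetters)))))
    simpa [size] using this
  have hl := hN
  simp only [h₀, List.length_append] at hl
  have hi : size (inputStore n s z x δ qs) ≤ N := by
    rw [size_inputStore]
    omega
  have hidle : Idle (inputStore n s z x δ qs) := ⟨rfl, rfl, rfl, rfl, rfl⟩
  have hlt (a b : ℕ) : (compare a b == .lt) = decide (a < b) := by
    rw [Bool.eq_iff_iff, beq_iff_eq, compare_lt_iff_lt, decide_eq_true_iff]
  let T (r : List Letter) (a b c d e : List Letter) : Store := fun k =>
    match k with
    | .arcs => r | .n => a | .path => b | .z => c | .x => d | .δ => e | _ => []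
  have hT (r a b c d e : List Letter) : size (T r a b c d e) = r.length + a.length + b.length +
      c.length + d.length + e.length := by
    have huniv : (Finset.univ : Finset Stk) = {.n, .z, .δ, .x, .arcs, .cur, .path, .frames, .delays,
      .p, .q, .w, .t, .a, .b, .c, .e} := rfl
    rw [size, huniv]
    simp [T]
    omega
  have hS₀ : S = T (field n ++ (field s ++ (field z ++ (field x ++
      (field δ ++ qs.flatMap quadLetters))))) [] [] [] [] [] := by
    subst hS
    funext k
    cases k <;> simp [T]
  rw [hS₀]
  refine .bind (S' := T (field s ++ (field z ++ (field x ++ (field δ ++ qs.flatMap quadLetters))))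
    (field n) [] [] [] []) (Runs.cast (runs_transfer (segment_field n _) rfl (by simp) (by simp)
    (by simp) rfl ?_) rfl ?_) ?_
  · simp only [hT, List.length_append, List.length_nil]
    omega
  · funext k
    cases k <;> simp [T]
  refine .bind (S' := T (field z ++ (field x ++ (field δ ++ qs.flatMap quadLetters)))
    (field n) (field s) [] [] []) (Runs.cast (runs_transfer (segment_field s _) rfl (by simp)
    (by simp) (by simp) rfl ?_) rfl ?_) ?_
  · simp only [hT, List.length_append, List.length_nil]
    omega
  · funext k
    cases k <;> simp [T]
  refine .bind (S' := T (field x ++ (field δ ++ qs.flatMap quadLetters))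
    (field n) (field s) (field z) [] []) (Runs.cast (runs_transfer (segment_field z _) rfl (by simp)
    (by simp) (by simp) rfl ?_) rfl ?_) ?_
  · simp only [hT, List.length_append, List.length_nil]
    omega
  · funext k
    cases k <;> simp [T]
  refine .bind (S' := T (field δ ++ qs.flatMap quadLetters)
    (field n) (field s) (field z) (field x) []) (Runs.cast (runs_transfer (segment_field x _) rfl
    (by simp) (by simp) (by simp) rfl ?_) rfl ?_) ?_
  · simp only [hT, List.length_append, List.length_nil]
    omega
  · funext k
    cases k <;> simp [T]
  refine .bind (S' := inputStore n s z x δ qs) (Runs.cast (runs_transfer (segment_field δ _) rfl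
    (by simp) (by simp) (by simp) rfl ?_) rfl ?_) ?_
  · simp only [hT, List.length_append, List.length_nil]
    omega
  · funext k
    cases k <;> simp [T, inputStore]
  refine .bind (runs_compareFields (u := s) (v := n) (r := []) (r' := [])
    (List.append_nil _).symm (List.append_nil _).symm hidle (by simp) (by simp) (by omega)) ?_
  refine .bind (runs_compareFields (u := z) (v := n) (r := []) (r' := [])
    (List.append_nil _).symm (List.append_nil _).symm hidle (by simp) (by simp) (by omega)) ?_
  refine .bind (runs_checkArcs (n := n) (qs := qs) rfl rfl hidle rfl hi (by omega)) ?_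
  exact Runs.cast (.pure (by omega)) (by rw [hlt, hlt]) rfl

/-- Pushes a position at time `0` below the frames. -/
def pushStart : Prog Unit :=
  (Cmd.push .frames .sep).bind fun _ => (Cmd.push .frames .sep).bind fun _ =>
  (Cmd.push .frames .sep).bind fun _ => Cmd.push .frames .sep

/-- The number `0` is the empty word, so each zero is a bare separator. -/
theorem runs_pushStart {B : ℕ} {S : Store} (hS : S .frames = []) (hB : size S + 4 ≤ B) :
    Runs B pushStart S () (Function.update S .frames (field 0 ++ (field 0 ++ (field 0 ++
      field 0)))) := by
  have h (l : List Letter) (s : Letter) (hl : l.length < 4) :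
      Runs B (Cmd.push .frames s) (Function.update S .frames l) ()
        (Function.update S .frames (s :: l)) :=
    Runs.cast (.push (size_update_add_le (by omega))) rfl (by simp)
  have h₁ := h [] .sep (by simp)
  rw [← hS, Function.update_eq_self, hS] at h₁
  exact .bind h₁ (.bind (h _ _ (by simp)) (.bind (h _ _ (by simp)) (h _ _ (by simp))))

/-- Clears some stacks. -/
def clearAll : List Stk → Prog Unit
  | [] => .pure ()
  | k :: ks => (drain (fun _ => false) k []).bind fun _ => clearAll ks

theorem runs_clearAll {B : ℕ} (ks : List Stk) (S : Store) (hB : size S ≤ B) :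
    Runs B (clearAll ks) S () (fun k => if k ∈ ks then [] else S k) := by
  induction ks generalizing S with
  | nil => exact Runs.cast (.pure hB) rfl (by simp)
  | cons k ks ih =>
    have h := runs_clear k S hB
    refine .bind h (Runs.cast (ih _ h.size_le.2) rfl ?_)
    funext j
    by_cases hj : j = k
    · subst hj
      simp
    · simp [hj]

/-- Decides the game, leaving the stacks in any state. -/
def playGame : Prog Bool :=
  readWord.bind fun q =>
    if wordAccepts q then readNumbers.bind fun b =>
      if b then pushStart.bind fun _ => search else .pure false
    else .pure false

theorem map_ofInput_encodeNats (l : List ℕ) : (encodeNats l).map ofInput = l.flatMap field := by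
  induction l with
  | nil => rfl
  | cons m l ih =>
    rw [encodeNats_cons, List.map_append, List.map_cons, ih, List.flatMap_cons, List.map_map]
    simp [field, ofInput]

theorem flatMap_field_flatMap_quad (qs : List (ℕ × ℕ × ℕ × ℕ)) :
    (qs.flatMap quad).flatMap field = qs.flatMap quadLetters := by
  rw [List.flatMap_assoc]
  congr 1
  funext q
  simp [quad, quadLetters]

theorem exists_list_of_length_eq (l : List ℕ) (m : ℕ) (h : l.length = 5 + 4 * m) :
    ∃ n s z x δ, ∃ qs : List (ℕ × ℕ × ℕ × ℕ), l = [n, s, z, x, δ] ++ qs.flatMap quad := by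
  match l, h with
  | [], h | [_], h | [_, _], h | [_, _, _], h | [_, _, _, _], h => exact absurd h (by simp; omega)
  | n :: s :: z :: x :: δ :: l, h =>
    obtain ⟨qs, rfl⟩ := exists_flatMap_quad m l (by simp at h; omega)
    exact ⟨n, s, z, x, δ, qs, rfl⟩

theorem exists_map_entries (n : ℕ) (qs : List (ℕ × ℕ × ℕ × ℕ))
    (h : ∀ q ∈ qs, q.1 < n ∧ q.2.1 < n) : ∃ l : List (TimeArc n), qs = l.map entries := by
  induction qs with
  | nil => exact ⟨[], rfl⟩
  | cons q qs ih =>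
    obtain ⟨l, rfl⟩ := ih fun q hq => h q (List.mem_cons_of_mem _ hq)
    have hq := h q List.mem_cons_self
    exact ⟨⟨⟨q.1, hq.1⟩, ⟨q.2.1, hq.2⟩, q.2.2.1, q.2.2.2⟩ :: l, rfl⟩

-- A word is rejected if it is no list of `5 + 4 * m` numbers or if a vertex is out of range, since
-- no instance has such an encoding. Otherwise it encodes an instance, unique by `eq_of_isEncoding`,
-- whose outcome the search returns.
open Classical in
theorem exists_runs_playGame (w : List (Option Bool)) {b : Bool}
    (hb : b = true ↔ w ∈ delayedRoutingPathGame) {B : ℕ}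
    (hB : 40 * (w.length * (w.length + 1) + w.length + 4) ≤ B) :
    ∃ S', Runs B playGame (Function.update (fun _ => []) .t (w.map ofInput).reverse) b S' := by
  have hread := runs_readWord (B := B) w (by omega)
  by_cases hacc : wordAccepts (wordState w) = true
  swap
  · have hb : b = false := by
      rw [← Bool.not_eq_true, hb]
      rintro ⟨G, ⟨l, -, hl⟩, -⟩
      refine hacc ((wordAccepts_iff w).2 ⟨_, l.length, hl, ?_⟩)
      rw [List.length_append, List.length_flatMap]
      simp
      omega
    rw [hb]
    refine ⟨Function.update (fun _ => []) .arcs (w.map ofInput), .bind hread ?_⟩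
    rw [if_neg hacc]
    exact .pure hread.size_le.2
  obtain ⟨l, m, rfl, hlen⟩ := (wordAccepts_iff w).1 hacc
  obtain ⟨n, s, z, x, δ, qs, rfl⟩ := exists_list_of_length_eq l m hlen
  have hmap : (encodeNats ([n, s, z, x, δ] ++ qs.flatMap quad)).map ofInput =
      field n ++ (field s ++ (field z ++ (field x ++ (field δ ++ qs.flatMap quadLetters)))) := by
    rw [map_ofInput_encodeNats, List.flatMap_append, flatMap_field_flatMap_quad]
    simp
  have hN := congrArg List.length hmap
  rw [List.length_map] at hN
  generalize hw : encodeNats ([n, s, z, x, δ] ++ qs.flatMap quad) = w at *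
  have hnum := runs_readNumbers (B := B) (N := w.length) (n := n) (s := s) (z := z) (x := x) (δ := δ)
    (qs := qs) (S := Function.update (fun _ => []) .arcs (w.map ofInput)) (by rw [hmap]) (by simp)
    (by omega)
  by_cases hok : s < n ∧ z < n ∧ ∀ q ∈ qs, q.1 < n ∧ q.2.1 < n
  swap
  · have hb : b = false := by
      rw [← Bool.not_eq_true, hb]
      rintro ⟨G, hG, -⟩
      obtain ⟨l, -, hl⟩ := (isEncoding_iff G w).1 hG
      have h := encodeNats_injective (hw.trans hl)
      simp only [List.cons_append, List.nil_append, List.cons.injEq] at h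
      obtain ⟨rfl, rfl, rfl, rfl, rfl, h⟩ := h
      obtain rfl := flatMap_quad_injective h
      refine hok ⟨G.s.2, G.z.2, fun q hq => ?_⟩
      obtain ⟨e, -, rfl⟩ := List.mem_map.1 hq
      exact ⟨e.src.2, e.dst.2⟩
    rw [hb]
    refine ⟨inputStore n s z x δ qs, .bind hread ?_⟩
    rw [if_pos hacc]
    refine .bind hnum ?_
    rw [if_neg]
    · exact .pure hnum.size_le.2
    · simpa [List.all_eq_true, and_assoc] using hok
  · obtain ⟨hs, hz, hq⟩ := hok
    obtain ⟨l, rfl⟩ := exists_map_entries n qs hq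
    -- The set of arcs forgets order and repetitions, while the search keeps working with the list
    -- `l` itself.
    let G : PathGame := ⟨n, l.toFinset, ⟨s, hs⟩, ⟨z, hz⟩, x, δ⟩
    have hG : G.IsEncoding w := (isEncoding_iff G w).2 ⟨l, fun e => by simp [G], hw.symm⟩
    have harcs : (l.map entries).flatMap quadLetters = l.flatMap arcLetters := by
      rw [List.flatMap_map]
      rfl
    rw [harcs] at hN
    simp only [List.length_append] at hN
    obtain ⟨S', hsearch⟩ := exists_runs_search_start (G := G) (B := B) (N := w.length) (l := l)
      (fun e => by simp [G]) (by change (field n).length + (field s).length + (field z).length +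
        (field x).length + (field δ).length + _ ≤ _; omega) hB
    have hb : decide G.TravelerWins = b := by
      rw [Bool.eq_iff_iff, decide_eq_true_iff, hb]
      refine ⟨fun h => ⟨G, hG, h⟩, ?_⟩
      rintro ⟨G', hG', h⟩
      rwa [eq_of_isEncoding hG hG']
    rw [hb] at hsearch
    refine ⟨S', .bind hread ?_⟩
    rw [if_pos hacc]
    refine .bind hnum ?_
    rw [if_pos (by simpa [List.all_eq_true, hs, hz] using hq)]
    refine .bind (a := ()) (Runs.cast (runs_pushStart rfl ?_) rfl ?_) hsearch
    · rw [size_inputStore, harcs]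
      omega
    · funext k
      cases k <;> simp [store, inputStore, harcs, G, field]

/-- All stacks. -/
def allStacks : List Stk :=
  [.n, .z, .δ, .x, .arcs, .cur, .path, .frames, .delays, .p, .q, .w, .t, .a, .b, .c, .e]

end Prog

theorem mainTheorem5 : delayedRoutingPathGame ∈ PSPACE (Option Bool) := by
  refine Cmd.mem_PSPACE Prog.ofInput .t
    -- The machine must halt with nothing but the answer bit, so all stacks are emptied after the
    -- game has been decided.
    (Prog.playGame.bind fun b => (Prog.clearAll Prog.allStacks).bind fun _ => .pure b)
    (40 * (.X * (.X + 1) + .X + 4)) _ fun w b hb => ?_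
  have e : (40 * (.X * (.X + 1) + .X + 4) : Polynomial ℕ).eval w.length =
      40 * (w.length * (w.length + 1) + w.length + 4) := by
    simp
  rw [e]
  obtain ⟨S', h⟩ := Prog.exists_runs_playGame w hb le_rfl
  have hc := Prog.runs_clearAll Prog.allStacks S' h.size_le.2
  have h0 : (fun k => if k ∈ Prog.allStacks then [] else S' k) = fun _ => [] := by
    funext k
    cases k <;> rfl
  rw [h0] at hc
  exact .bind h (.bind hc (.pure hc.size_le.2))
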